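/- Let $\eta(\tau)=e^{2\pi i\tau/24}\prod_{n\ge1}(1-e^{2\pi i n\tau})$ be the Dedekind eta function on the upper half-plane $\mathbb H$, let $g(\tau)=\eta^4(\tau)\,\eta^2(2\tau)\,\eta^4(4\tau)$, and let $a_n$ ($n\ge 0$) be the Fourier coefficients of $g$, that is, the Taylor coefficients at $q=0$ of $g$ regarded as a function of $q=e^{2\pi i\tau}$. For $0\le k<1$ let $$K(k)=\int_0^1\frac{du}{\sqrt{(1-u^2)(1-k^2u^2)}},$$ and for $0<k\le1$ let $K'(k)=K\big(\sqrt{1-k^2}\big)$. Then $g(\tau)=\sum_{n=1}^\infty a_n e^{2\pi i n\tau}$ for every $\tau\in\mathbb H$; the series $L(g,4)=\sum_{n=1}^\infty a_n n^{-4}$ converges absolutely, and $$L(g,4)=\frac{\Gamma^8\left(\frac14\right)}{3840\,\pi^2}.$$ Moreover, $K'^3$ is integrable on $(0,1)$, and $$\int_0^1 K'(k)^3\,dk=\frac{\Gamma^8\left(\frac14\right)}{128\,\pi^2}.$$ -/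

import Mathlib

open scoped UpperHalfPlane ModularForm
open Complex (I)

/-- The eta quotient `g(τ) = η(τ)⁴ η(2τ)² η(4τ)⁴` on the upper half-plane, where `η` is the
Dedekind eta function. -/
noncomputable def etaQuotientG (τ : ℍ) : ℂ :=
  ModularForm.eta (τ : ℂ) ^ 4 * ModularForm.eta (2 * (τ : ℂ)) ^ 2 *
    ModularForm.eta (4 * (τ : ℂ)) ^ 4

/-- The `n`-th Fourier coefficient `aₙ` of a `1`-periodic function `f` on the upper half-plane,
i.e. the `n`-th Taylor coefficient at `q = 0` of `f` written as a function of `q = e^{2πiτ}`. -/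
noncomputable def fourierCoefficient (f : ℍ → ℂ) (n : ℕ) : ℂ :=
  (UpperHalfPlane.qExpansion 1 f).coeff n

/-- The complete elliptic integral of the first kind
`K(k) = ∫₀¹ du / √((1 - u²)(1 - k²u²))`, for `0 ≤ k < 1`. -/
noncomputable def ellipticK (k : ℝ) : ℝ :=
  ∫ u in (0 : ℝ)..1, 1 / Real.sqrt ((1 - u ^ 2) * (1 - k ^ 2 * u ^ 2))

/-- The complementary integral `K'(k) = K(k')` with `k' = √(1 - k²)`, for `0 < k ≤ 1`. -/
noncomputable def ellipticK' (k : ℝ) : ℝ :=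
  ellipticK (Real.sqrt (1 - k ^ 2))

/-! Both evaluations come from the Hecke character α ↦ α⁴ on ℤ[i]. Its theta series ∑ α⁴ q^N(α)
equals 4g at q = e^{2πiτ}, so aₙ is a quarter of the sum of α⁴ over the elements of norm n. Since
N(α) = αᾱ, L(g,4) = ¼ ∑ ᾱ⁻⁴, an Eisenstein sum over the square lattice, i.e. a multiple of E₄(i).

To identify the theta series, let A, B, C be the three theta constants as power series in q and D =
q d/dq. Expanding (m + ni)⁴ leaves the moment identity `thetaMoment_identity`, which is the Riccati
equation `eulerD_logThetaA` for D log A in disguise. The differential equations follow from the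
duplication formulas: the quantity in question satisfies a functional equation under q ↦ q², and
since q^(2ⁿ) → 0 it is determined by its behaviour at the origin. The link with η
(`eulerProd_quotient`) starts from (θ₂θ₃θ₄)⁸, a cusp form of weight 12 and level one, hence a
multiple of Δ; roots are then extracted by connectedness of the disc.

Jacobi's formula 2E₄ = θ₂⁸ + θ₃⁸ + θ₄⁸ and the fixed point i of τ ↦ -1/τ give E₄(i) = ¾ θ₃(i)⁸.
Gauss's arithmetic-geometric mean integral, invariant along (θ₃², θ₄²), evaluates θ₃(i)² by a beta
integral.

For the moment, put k = θ₂²/θ₃² at it. Then K' = (π/2) t θ₃² and dk/dt = -(π/2) θ₄⁴ k, so the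
integral is (π/2)⁴ times the Mellin transform at 4 of θ₂²θ₃⁴θ₄⁴. That product is the theta series of
the same character restricted to odd norms (`hasSum_gauss_pow_four_odd`); discarding the multiples
of 1 + i multiplies the Eisenstein sum by 5/4. -/

/-! ### Theta-type power series: convergence and termwise differentiation -/

/-- The series `∑ cₙ q ^ e(n)` over the integers. -/
noncomputable def thetaSeries (c : ℤ → ℂ) (e : ℤ → ℕ) (q : ℂ) : ℂ := ∑' n : ℤ, c n * q ^ e n

/-- Exponent functions that grow at least linearly and at most quadratically. -/
structure IsThetaExponent (e : ℤ → ℕ) : Prop where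
  natAbs_le : ∀ n, n.natAbs ≤ e n + 1
  le_sq : ∀ n, e n ≤ 2 * n.natAbs ^ 2

/-- Coefficients of polynomial growth. -/
def PolyBounded (c : ℤ → ℂ) : Prop := ∃ k : ℕ, ∀ n, ‖c n‖ ≤ ((n.natAbs : ℝ) + 1) ^ k

lemma summable_natAbs_add_one_pow_mul_geometric (k : ℕ) {r : ℝ} (h0 : 0 < r) (h1 : r < 1) :
    Summable fun n : ℤ ↦ ((n.natAbs : ℝ) + 1) ^ k * r ^ n.natAbs := by
  have h : Summable fun n : ℕ ↦ ((n : ℝ) + 1) ^ k * r ^ n := by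
    have := (summable_nat_add_iff 1).mpr
      (summable_pow_mul_geometric_of_norm_lt_one (R := ℝ) k (r := r)
        (by rwa [Real.norm_of_nonneg h0.le]))
    refine (this.mul_left r⁻¹).congr fun n ↦ ?_
    push_cast
    rw [pow_succ]
    field_simp
  exact .of_nat_of_neg (by simpa using h) (by simpa using h)

lemma IsThetaExponent.summable_norm {c : ℤ → ℂ} {e : ℤ → ℕ} (he : IsThetaExponent e)
    (hc : PolyBounded c) {q : ℂ} (hq : ‖q‖ < 1) : Summable fun n ↦ ‖c n * q ^ e n‖ := by
  obtain ⟨k, hk⟩ := hc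
  obtain ⟨r, hr, hr1⟩ := exists_between hq
  have hr0 : 0 < r := (norm_nonneg q).trans_lt hr
  refine .of_nonneg_of_le (fun _ ↦ norm_nonneg _) (fun n ↦ ?_)
    ((summable_natAbs_add_one_pow_mul_geometric k hr0 hr1).mul_left r⁻¹)
  rw [norm_mul, norm_pow]
  have h1 : ‖q‖ ^ e n ≤ r⁻¹ * r ^ n.natAbs := by
    refine (pow_le_pow_left₀ (norm_nonneg _) hr.le _).trans ?_
    rw [le_inv_mul_iff₀ hr0, ← pow_succ']
    exact pow_le_pow_of_le_one hr0.le hr1.le (he.natAbs_le n)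
  calc _ ≤ ((n.natAbs : ℝ) + 1) ^ k * (r⁻¹ * r ^ n.natAbs) := by
        gcongr
        exact hk n
    _ = _ := by ring

lemma IsThetaExponent.hasDerivAt {c : ℤ → ℂ} {e : ℤ → ℕ} (he : IsThetaExponent e)
    (hc : PolyBounded c) {q : ℂ} (hq : ‖q‖ < 1) :
    HasDerivAt (thetaSeries c e) (∑' n, c n * (e n * q ^ (e n - 1))) q := by
  have hc' := hc
  obtain ⟨k, hk⟩ := hc
  obtain ⟨r, hr, hr1⟩ := exists_between hq
  have hr0 : 0 < r := (norm_nonneg q).trans_lt hr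
  refine hasDerivAt_tsum_of_isPreconnected (t := Metric.ball 0 r) (y₀ := q)
    (g := fun n q ↦ c n * q ^ e n)
    (g' := fun n q ↦ c n * (e n * q ^ (e n - 1)))
    (u := fun n ↦ (2 * (r ^ 2)⁻¹) * (((n.natAbs : ℝ) + 1) ^ (k + 2) * r ^ n.natAbs))
    ((summable_natAbs_add_one_pow_mul_geometric (k + 2) hr0 hr1).mul_left _) Metric.isOpen_ball
    (convex_ball 0 r).isPreconnected (fun n y _ ↦ (hasDerivAt_pow _ _).const_mul _)
    (fun n y hy ↦ ?_) (by simpa using hr) (he.summable_norm hc' hq).of_norm (by simpa using hr)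
  have hy : ‖y‖ < r := by simpa using hy
  rw [norm_mul, norm_mul, norm_pow, Complex.norm_natCast]
  -- The loss is r⁻² rather than r⁻¹: |n| ≤ e(n) + 1 ≤ (e(n) - 1) + 2, also when the truncated
  -- subtraction gives 0.
  have h1 : ‖y‖ ^ (e n - 1) ≤ (r ^ 2)⁻¹ * r ^ n.natAbs := by
    refine (pow_le_pow_left₀ (norm_nonneg _) hy.le _).trans ?_
    rw [le_inv_mul_iff₀ (by positivity), ← pow_add]
    exact pow_le_pow_of_le_one hr0.le hr1.le (by have := he.natAbs_le n; omega)
  have h2 : (e n : ℝ) ≤ 2 * ((n.natAbs : ℝ) + 1) ^ 2 := by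
    have : (e n : ℝ) ≤ 2 * (n.natAbs : ℝ) ^ 2 := mod_cast he.le_sq n
    have h0 : (0 : ℝ) ≤ n.natAbs := by positivity
    nlinarith
  calc _ ≤ ((n.natAbs : ℝ) + 1) ^ k * ((2 * ((n.natAbs : ℝ) + 1) ^ 2) *
        ((r ^ 2)⁻¹ * r ^ n.natAbs)) := by
        gcongr
        exact hk n
    _ = _ := by ring

lemma IsThetaExponent.differentiableOn {c : ℤ → ℂ} {e : ℤ → ℕ} (he : IsThetaExponent e)
    (hc : PolyBounded c) : DifferentiableOn ℂ (thetaSeries c e) (Metric.ball 0 1) :=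
  fun _ hq ↦ (he.hasDerivAt hc (by simpa using hq)).differentiableAt.differentiableWithinAt

lemma IsThetaExponent.mul_deriv {c : ℤ → ℂ} {e : ℤ → ℕ} (he : IsThetaExponent e)
    (hc : PolyBounded c) {q : ℂ} (hq : ‖q‖ < 1) :
    q * deriv (thetaSeries c e) q = thetaSeries (fun n ↦ c n * e n) e q := by
  rw [(he.hasDerivAt hc hq).deriv, ← tsum_mul_left, thetaSeries]
  refine tsum_congr fun n ↦ ?_
  rcases Nat.eq_zero_or_pos (e n) with h | h
  · simp [h]
  · conv_rhs => rw [← Nat.sub_add_cancel h, pow_succ]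
    push_cast [Nat.cast_sub h]
    ring

/-- The exponent `n ↦ n²`. -/
def sqExponent (n : ℤ) : ℕ := n.natAbs ^ 2

/-- The exponent `n ↦ n² + n`. -/
def pronicExponent (n : ℤ) : ℕ := (n ^ 2 + n).toNat

lemma natCast_sqExponent (n : ℤ) : (sqExponent n : ℤ) = n ^ 2 := by simp [sqExponent]

lemma natCast_pronicExponent (n : ℤ) : (pronicExponent n : ℤ) = n ^ 2 + n := by
  refine Int.toNat_of_nonneg ?_
  rcases le_or_gt 0 n with h | h <;> nlinarith

lemma isThetaExponent_sq : IsThetaExponent sqExponent where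
  natAbs_le n := by
    zify
    rw [natCast_sqExponent, ← sq_abs]
    nlinarith [sq_nonneg (|n| - 1)]
  le_sq n := by
    unfold sqExponent
    omega

lemma isThetaExponent_pronic : IsThetaExponent pronicExponent where
  natAbs_le n := by
    zify
    rw [natCast_pronicExponent]
    rcases abs_cases n with ⟨h, _⟩ | ⟨h, _⟩ <;> rw [h] <;> nlinarith [sq_nonneg (n + 1)]
  le_sq n := by
    zify
    rw [natCast_pronicExponent, sq_abs]
    rcases lt_or_ge 0 n with h | h <;> nlinarith

lemma polyBounded_one : PolyBounded 1 := ⟨0, by simp⟩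

lemma polyBounded_sign : PolyBounded fun n ↦ (-1) ^ n.natAbs := ⟨0, by simp⟩

lemma polyBounded_pow (k : ℕ) : PolyBounded fun n ↦ (n : ℂ) ^ k := by
  refine ⟨k, fun n ↦ ?_⟩
  rw [norm_pow]
  gcongr
  rw [Complex.norm_intCast, Nat.cast_natAbs]
  push_cast
  linarith

/-- `∑ q ^ n²`. -/
noncomputable abbrev thetaA : ℂ → ℂ := thetaSeries 1 sqExponent

/-- `∑ (-1) ^ n q ^ n²`. -/
noncomputable abbrev thetaB : ℂ → ℂ := thetaSeries (fun n ↦ (-1) ^ n.natAbs) sqExponent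

/-- `∑ q ^ (n² + n)`. -/
noncomputable abbrev thetaC : ℂ → ℂ := thetaSeries 1 pronicExponent

/-! ### Duplication formulas -/

/-- The pairs of equal parity form the sublattice {(a + b, a - b)}, those of opposite parity its
translate by (1, 0). All the duplication formulas rest on this splitting. -/
lemma tsum_int_prod_eq_add {F : ℤ × ℤ → ℂ} (hF : Summable F) :
    ∑' p, F p = (∑' p : ℤ × ℤ, F (p.1 + p.2, p.1 - p.2)) +
      ∑' p : ℤ × ℤ, F (p.1 + p.2 + 1, p.1 - p.2) := by
  set f : ℤ × ℤ → ℤ × ℤ := fun p ↦ (p.1 + p.2, p.1 - p.2)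
  set g : ℤ × ℤ → ℤ × ℤ := fun p ↦ (p.1 + p.2 + 1, p.1 - p.2)
  have hf : f.Injective := by
    rintro ⟨a, b⟩ ⟨c, d⟩ h
    simp only [f, Prod.mk.injEq] at h ⊢
    omega
  have hg : g.Injective := by
    rintro ⟨a, b⟩ ⟨c, d⟩ h
    simp only [g, Prod.mk.injEq] at h ⊢
    omega
  have hfg : (Set.range f)ᶜ = Set.range g := by
    ext ⟨a, b⟩
    simp only [Set.mem_compl_iff, Set.mem_range, f, g, Prod.mk.injEq, Prod.exists, not_exists]
    constructor
    · intro h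
      refine ⟨(a + b - 1) / 2, (a - b - 1) / 2, ?_⟩
      have := h ((a + b) / 2) ((a - b) / 2)
      omega
    · rintro ⟨x, y, h⟩ x' y'
      omega
  have h := hF.tsum_subtype_add_tsum_subtype_compl (Set.range f)
  rw [hfg, tsum_range F hf, tsum_range F hg] at h
  exact h.symm

lemma IsThetaExponent.summable_mul {c d : ℤ → ℂ} {e f : ℤ → ℕ} (he : IsThetaExponent e)
    (hc : PolyBounded c) (hf : IsThetaExponent f) (hd : PolyBounded d) {q : ℂ} (hq : ‖q‖ < 1) :
    Summable fun p : ℤ × ℤ ↦ c p.1 * q ^ e p.1 * (d p.2 * q ^ f p.2) :=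
  summable_mul_of_summable_norm (f := fun n ↦ c n * q ^ e n) (g := fun n ↦ d n * q ^ f n)
    (he.summable_norm hc hq) (hf.summable_norm hd hq)

lemma IsThetaExponent.mul_eq_tsum {c d : ℤ → ℂ} {e f : ℤ → ℕ} (he : IsThetaExponent e)
    (hc : PolyBounded c) (hf : IsThetaExponent f) (hd : PolyBounded d) {q : ℂ} (hq : ‖q‖ < 1) :
    thetaSeries c e q * thetaSeries d f q =
      ∑' p : ℤ × ℤ, c p.1 * q ^ e p.1 * (d p.2 * q ^ f p.2) :=
  tsum_mul_tsum_of_summable_norm (f := fun n ↦ c n * q ^ e n) (g := fun n ↦ d n * q ^ f n)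
    (he.summable_norm hc hq) (hf.summable_norm hd hq)

lemma norm_sq_lt_one {q : ℂ} (hq : ‖q‖ < 1) : ‖q ^ 2‖ < 1 := by
  rw [norm_pow]
  exact pow_lt_one₀ (norm_nonneg _) hq two_ne_zero

/-- On the two classes the exponent is (a+b)² + (a-b)² = 2(a² + b²) and (a+b+1)² + (a-b)² = 2(a² + a
+ b² + b) + 1. -/
lemma thetaA_sq {q : ℂ} (hq : ‖q‖ < 1) :
    thetaA q ^ 2 = thetaA (q ^ 2) ^ 2 + q * thetaC (q ^ 2) ^ 2 := by
  have hA := isThetaExponent_sq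
  have hC := isThetaExponent_pronic
  have h1 := polyBounded_one
  have hq2 := norm_sq_lt_one hq
  simp only [sq (thetaSeries _ _ _)]
  rw [hA.mul_eq_tsum h1 hA h1 hq, hA.mul_eq_tsum h1 hA h1 hq2, hC.mul_eq_tsum h1 hC h1 hq2,
    tsum_int_prod_eq_add (hA.summable_mul h1 hA h1 hq), ← tsum_mul_left]
  congr 1 <;> refine tsum_congr fun p ↦ ?_
  · simp only [Pi.one_apply, one_mul, ← pow_mul, ← pow_add]
    congr 1
    zify
    simp only [natCast_sqExponent]
    ring
  · simp only [Pi.one_apply, one_mul, ← pow_mul, ← pow_add, ← pow_succ']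
    congr 1
    zify
    simp only [natCast_sqExponent, natCast_pronicExponent]
    ring

lemma neg_one_pow_natAbs_add_sub (a b : ℤ) :
    (-1 : ℂ) ^ (a + b).natAbs * (-1) ^ (a - b).natAbs = 1 := by
  rw [← pow_add]
  exact Even.neg_one_pow (by grind)

lemma neg_one_pow_natAbs_add_one_sub (a b : ℤ) :
    (-1 : ℂ) ^ (a + b + 1).natAbs * (-1) ^ (a - b).natAbs = -1 := by
  rw [← pow_add]
  exact Odd.neg_one_pow (by grind)

lemma thetaB_sq {q : ℂ} (hq : ‖q‖ < 1) :
    thetaB q ^ 2 = thetaA (q ^ 2) ^ 2 - q * thetaC (q ^ 2) ^ 2 := by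
  have hA := isThetaExponent_sq
  have hC := isThetaExponent_pronic
  have h1 := polyBounded_one
  have hs := polyBounded_sign
  have hq2 := norm_sq_lt_one hq
  simp only [sq (thetaSeries _ _ _)]
  rw [hA.mul_eq_tsum hs hA hs hq, hA.mul_eq_tsum h1 hA h1 hq2, hC.mul_eq_tsum h1 hC h1 hq2,
    tsum_int_prod_eq_add (hA.summable_mul hs hA hs hq), ← tsum_mul_left, sub_eq_add_neg,
    ← tsum_neg]
  congr 1 <;> refine tsum_congr fun p ↦ ?_
  · rw [mul_mul_mul_comm, neg_one_pow_natAbs_add_sub]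
    simp only [Pi.one_apply, one_mul, ← pow_mul, ← pow_add]
    congr 1
    zify
    simp only [natCast_sqExponent]
    ring
  · rw [mul_mul_mul_comm, neg_one_pow_natAbs_add_one_sub]
    simp only [Pi.one_apply, one_mul, ← pow_mul, ← pow_add, ← pow_succ', neg_mul]
    congr 2
    zify
    simp only [natCast_sqExponent, natCast_pronicExponent]
    ring

lemma thetaC_sq {q : ℂ} (hq : ‖q‖ < 1) :
    thetaC q ^ 2 = 2 * thetaA (q ^ 2) * thetaC (q ^ 2) := by
  have hA := isThetaExponent_sq
  have hC := isThetaExponent_pronic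
  have h1 := polyBounded_one
  have hq2 := norm_sq_lt_one hq
  have hCA : thetaC (q ^ 2) * thetaA (q ^ 2) = _ := hC.mul_eq_tsum h1 hA h1 hq2
  have hAC : thetaA (q ^ 2) * thetaC (q ^ 2) = _ := hA.mul_eq_tsum h1 hC h1 hq2
  have : thetaC q * thetaC q = thetaC (q ^ 2) * thetaA (q ^ 2) +
      thetaA (q ^ 2) * thetaC (q ^ 2) := by
    rw [hC.mul_eq_tsum h1 hC h1 hq, hCA, hAC,
      tsum_int_prod_eq_add (hC.summable_mul h1 hC h1 hq),
      -- On the odd class the exponent is 2(a+1)² + 2(b² + b), hence the shift of a by one.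
      ← ((Equiv.addRight (1 : ℤ)).prodCongr (Equiv.refl ℤ)).tsum_eq
        (fun p : ℤ × ℤ ↦ (1 : ℤ → ℂ) p.1 * (q ^ 2) ^ sqExponent p.1 *
        ((1 : ℤ → ℂ) p.2 * (q ^ 2) ^ pronicExponent p.2))]
    congr 1 <;> refine tsum_congr fun p ↦ ?_
    all_goals
      simp only [Pi.one_apply, one_mul, ← pow_mul, ← pow_add, Equiv.prodCongr_apply,
        Prod.map_fst, Prod.map_snd, Equiv.coe_addRight, Equiv.refl_apply]
      congr 1
      zify
      simp only [natCast_sqExponent, natCast_pronicExponent]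
      ring
  linear_combination this

lemma thetaA_mul_thetaB {q : ℂ} (hq : ‖q‖ < 1) :
    thetaA q * thetaB q = thetaB (q ^ 2) ^ 2 := by
  have hA := isThetaExponent_sq
  have h1 := polyBounded_one
  have hs := polyBounded_sign
  have hq2 := norm_sq_lt_one hq
  rw [sq (thetaSeries _ _ _), hA.mul_eq_tsum h1 hA hs hq, hA.mul_eq_tsum hs hA hs hq2,
    tsum_int_prod_eq_add (hA.summable_mul h1 hA hs hq)]
  have h0 : ∑' p : ℤ × ℤ, (1 : ℤ → ℂ) (p.1 + p.2 + 1) * q ^ sqExponent (p.1 + p.2 + 1) *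
      ((-1) ^ (p.1 - p.2).natAbs * q ^ sqExponent (p.1 - p.2)) = 0 := by
    -- The odd class cancels: (a, b) ↦ (-1-b, a) exchanges a+b+1 and a-b up to sign. It preserves
    -- the exponent and flips the sign, since these two integers have opposite parity.
    rw [← CharZero.eq_neg_self_iff, ← tsum_neg]
    conv_lhs => rw [← ((Equiv.subLeft (-1 : ℤ)).prodCongr (Equiv.refl ℤ)).tsum_eq,
      ← (Equiv.prodComm ℤ ℤ).tsum_eq]
    refine tsum_congr fun p ↦ ?_
    simp only [Pi.one_apply, one_mul, Equiv.prodCongr_apply, Prod.map_fst, Prod.map_snd,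
      Equiv.subLeft_apply, Equiv.refl_apply, Equiv.prodComm_apply, Prod.fst_swap, Prod.snd_swap]
    rw [mul_left_comm, ← pow_add, mul_left_comm, ← pow_add, ← neg_mul]
    congr 1
    · have h (k : ℕ) : -(-1 : ℂ) ^ k = (-1) ^ (k + 1) := by ring
      rw [h]
      exact neg_one_pow_congr (by grind)
    · congr 1
      zify
      simp only [natCast_sqExponent]
      ring
  rw [h0, add_zero]
  refine tsum_congr fun p ↦ ?_
  simp only [Pi.one_apply, one_mul]
  rw [mul_left_comm, ← pow_add, mul_mul_mul_comm, ← pow_mul, ← pow_mul, ← pow_add, ← pow_add]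
  congr 1
  · exact neg_one_pow_congr (by grind)
  · congr 1
    zify
    simp only [natCast_sqExponent]
    ring

/-- Jacobi's identity θ₃⁴ - θ₄⁴ = θ₂⁴: factor the left side as (A² - B²)(A² + B²) = 2qC(q²)² ·
2A(q²)² and apply the duplication of C. -/
lemma thetaA_pow_four_sub {q : ℂ} (hq : ‖q‖ < 1) :
    thetaA q ^ 4 - thetaB q ^ 4 = q * thetaC q ^ 4 := by
  linear_combination (thetaA q ^ 2 + thetaA (q ^ 2) ^ 2 + q * thetaC (q ^ 2) ^ 2) * thetaA_sq hq -
    (thetaB q ^ 2 + thetaA (q ^ 2) ^ 2 - q * thetaC (q ^ 2) ^ 2) * thetaB_sq hq -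
    q * (thetaC q ^ 2 + 2 * thetaA (q ^ 2) * thetaC (q ^ 2)) * thetaC_sq hq

lemma thetaA_neg (q : ℂ) : thetaA (-q) = thetaB q := by
  refine tsum_congr fun n ↦ ?_
  rw [neg_pow, Pi.one_apply, one_mul]
  congr 1
  exact neg_one_pow_congr (by simp [sqExponent, Nat.even_pow])

lemma thetaB_neg (q : ℂ) : thetaB (-q) = thetaA q := by
  rw [← thetaA_neg, neg_neg]

lemma thetaC_neg (q : ℂ) : thetaC (-q) = thetaC q := by
  refine tsum_congr fun n ↦ ?_
  rw [Even.neg_pow]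
  have : Even (pronicExponent n : ℤ) := by
    rw [natCast_pronicExponent, sq, ← mul_add_one]
    exact Int.even_mul_succ_self n
  exact_mod_cast this

lemma thetaA_zero : thetaA 0 = 1 := by
  unfold thetaA thetaSeries
  rw [tsum_eq_single 0]
  · simp [sqExponent]
  · intro n hn
    simp [sqExponent, hn]

lemma thetaB_zero : thetaB 0 = 1 := by rw [← thetaA_neg, neg_zero, thetaA_zero]

lemma thetaC_zero : thetaC 0 = 2 := by
  unfold thetaC thetaSeries
  rw [tsum_eq_sum (s := {0, -1})]
  · rw [Finset.sum_pair (by norm_num)]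
    simp [pronicExponent]
    norm_num
  · intro n hn
    have : pronicExponent n ≠ 0 := by
      simp only [Finset.mem_insert, Finset.mem_singleton, not_or] at hn
      zify
      rw [natCast_pronicExponent]
      have : n * (n + 1) ≠ 0 := mul_ne_zero hn.1 (by omega)
      grind
    simp [this]

lemma differentiableOn_thetaA : DifferentiableOn ℂ thetaA (Metric.ball 0 1) :=
  isThetaExponent_sq.differentiableOn polyBounded_one

lemma differentiableOn_thetaB : DifferentiableOn ℂ thetaB (Metric.ball 0 1) :=
  isThetaExponent_sq.differentiableOn polyBounded_sign

lemma differentiableOn_thetaC : DifferentiableOn ℂ thetaC (Metric.ball 0 1) :=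
  isThetaExponent_pronic.differentiableOn polyBounded_one

/-! ### Iterating q ↦ q²; nonvanishing of the theta constants -/

lemma zero_mem_ball_one : (0 : ℂ) ∈ Metric.ball (0 : ℂ) 1 := by simp

lemma ball_one_mem_nhds_zero : Metric.ball (0 : ℂ) 1 ∈ nhds 0 := Metric.ball_mem_nhds _ one_pos

lemma tendsto_pow_two_pow_nhds_zero {q : ℂ} (hq : ‖q‖ < 1) :
    Filter.Tendsto (fun n : ℕ ↦ q ^ 2 ^ n) Filter.atTop (nhds 0) :=
  (tendsto_pow_atTop_nhds_zero_of_norm_lt_one hq).comp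
    (tendsto_pow_atTop_atTop_of_one_lt one_lt_two)

/-- A continuous function on the disc whose zeros propagate under squaring has no zeros unless it
vanishes at the origin. -/
lemma ne_zero_of_eq_zero_sq {f : ℂ → ℂ} (hf : ContinuousAt f 0) (h0 : f 0 ≠ 0)
    (h : ∀ q, ‖q‖ < 1 → f q = 0 → f (q ^ 2) = 0) {q : ℂ} (hq : ‖q‖ < 1) : f q ≠ 0 := by
  intro hfq
  have hn : ∀ n : ℕ, ‖q ^ 2 ^ n‖ < 1 ∧ f (q ^ 2 ^ n) = 0 := by
    intro n
    induction n with
    | zero => simpa using ⟨hq, hfq⟩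
    | succ n ih =>
      rw [pow_succ, pow_mul]
      exact ⟨norm_sq_lt_one ih.1, h _ ih.1 ih.2⟩
  refine h0 (tendsto_nhds_unique (hf.tendsto.comp (tendsto_pow_two_pow_nhds_zero hq)) ?_)
  simp only [Function.comp_def, (hn _).2, tendsto_const_nhds]

/-- A function on the disc that is continuous at the origin and invariant under squaring is
constant. -/
lemma eq_apply_zero_of_eq_sq {f : ℂ → ℂ} (hf : ContinuousAt f 0)
    (h : ∀ q, ‖q‖ < 1 → f q = f (q ^ 2)) {q : ℂ} (hq : ‖q‖ < 1) : f q = f 0 := by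
  have hn : ∀ n : ℕ, ‖q ^ 2 ^ n‖ < 1 ∧ f (q ^ 2 ^ n) = f q := by
    intro n
    induction n with
    | zero => simpa using hq
    | succ n ih =>
      rw [pow_succ, pow_mul]
      exact ⟨norm_sq_lt_one ih.1, (h _ ih.1).symm.trans ih.2⟩
  refine tendsto_nhds_unique ?_ (hf.tendsto.comp (tendsto_pow_two_pow_nhds_zero hq))
  simp only [Function.comp_def, (hn _).2, tendsto_const_nhds]

lemma continuousAt_thetaA_zero : ContinuousAt thetaA 0 :=
  differentiableOn_thetaA.continuousOn.continuousAt ball_one_mem_nhds_zero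

lemma continuousAt_thetaB_zero : ContinuousAt thetaB 0 :=
  differentiableOn_thetaB.continuousOn.continuousAt ball_one_mem_nhds_zero

lemma continuousAt_thetaC_zero : ContinuousAt thetaC 0 :=
  differentiableOn_thetaC.continuousOn.continuousAt ball_one_mem_nhds_zero

lemma thetaB_ne_zero {q : ℂ} (hq : ‖q‖ < 1) : thetaB q ≠ 0 := by
  refine ne_zero_of_eq_zero_sq continuousAt_thetaB_zero (by simp [thetaB_zero])
    (fun q hq h ↦ ?_) hq
  have := thetaA_mul_thetaB hq
  rw [h, mul_zero] at this
  exact pow_eq_zero_iff two_ne_zero |>.mp this.symm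

lemma thetaA_ne_zero {q : ℂ} (hq : ‖q‖ < 1) : thetaA q ≠ 0 := by
  rw [← thetaB_neg]
  exact thetaB_ne_zero (by simpa using hq)

lemma thetaC_ne_zero {q : ℂ} (hq : ‖q‖ < 1) : thetaC q ≠ 0 := by
  refine ne_zero_of_eq_zero_sq continuousAt_thetaC_zero (by simp [thetaC_zero])
    (fun q hq h ↦ ?_) hq
  have := thetaC_sq hq
  rw [h] at this
  simpa [thetaA_ne_zero (norm_sq_lt_one hq)] using this.symm

/-! ### Logarithmic derivatives and their differential equations -/

/-- The Euler operator `q d/dq`. -/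
noncomputable def eulerD (f : ℂ → ℂ) (q : ℂ) : ℂ := q * deriv f q

lemma DifferentiableOn.eulerD {f : ℂ → ℂ} (hf : DifferentiableOn ℂ f (Metric.ball 0 1)) :
    DifferentiableOn ℂ (eulerD f) (Metric.ball 0 1) :=
  differentiableOn_id.mul (hf.deriv Metric.isOpen_ball)

lemma ball_one_mem_nhds {q : ℂ} (hq : ‖q‖ < 1) : Metric.ball (0 : ℂ) 1 ∈ nhds q :=
  Metric.isOpen_ball.mem_nhds (by simpa using hq)

lemma DifferentiableOn.hasDerivAt_of_norm_lt {f : ℂ → ℂ}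
    (hf : DifferentiableOn ℂ f (Metric.ball 0 1)) {q : ℂ} (hq : ‖q‖ < 1) :
    HasDerivAt f (_root_.deriv f q) q :=
  (hf.differentiableAt (ball_one_mem_nhds hq)).hasDerivAt

lemma DifferentiableOn.hasDerivAt_comp_sq {f : ℂ → ℂ}
    (hf : DifferentiableOn ℂ f (Metric.ball 0 1)) {q : ℂ} (hq : ‖q‖ < 1) :
    HasDerivAt (fun x ↦ f (x ^ 2)) (_root_.deriv f (q ^ 2) * (2 * q)) q := by
  simpa [Function.comp_def] using
    (hf.hasDerivAt_of_norm_lt (norm_sq_lt_one hq)).comp q (hasDerivAt_pow 2 q)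

lemma HasDerivAt.unique_of_eq_ball {f g : ℂ → ℂ} {f' g' q : ℂ} (hq : ‖q‖ < 1)
    (hf : HasDerivAt f f' q) (hg : HasDerivAt g g' q) (h : ∀ x, ‖x‖ < 1 → f x = g x) : f' = g' :=
  hf.unique (hg.congr_of_eventuallyEq (by
    filter_upwards [ball_one_mem_nhds hq] with x hx using h x (by simpa using hx)))

section

variable {q : ℂ}

lemma thetaA_mul_eulerD (hq : ‖q‖ < 1) : thetaA q * eulerD thetaA q =
    2 * thetaA (q ^ 2) * eulerD thetaA (q ^ 2) + q * thetaC (q ^ 2) ^ 2 / 2 +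
      2 * q * thetaC (q ^ 2) * eulerD thetaC (q ^ 2) := by
  have h := HasDerivAt.unique_of_eq_ball hq
    ((differentiableOn_thetaA.hasDerivAt_of_norm_lt hq).pow 2)
    (((differentiableOn_thetaA.hasDerivAt_comp_sq hq).pow 2).add
      ((hasDerivAt_id q).mul ((differentiableOn_thetaC.hasDerivAt_comp_sq hq).pow 2)))
    fun x hx ↦ thetaA_sq hx
  simp only [id, Pi.pow_apply] at h
  norm_num at h
  unfold eulerD
  linear_combination q / 2 * h

lemma thetaC_mul_eulerD (hq : ‖q‖ < 1) : thetaC q * eulerD thetaC q =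
    2 * eulerD thetaA (q ^ 2) * thetaC (q ^ 2) + 2 * thetaA (q ^ 2) * eulerD thetaC (q ^ 2) := by
  have h := HasDerivAt.unique_of_eq_ball hq
    ((differentiableOn_thetaC.hasDerivAt_of_norm_lt hq).pow 2)
    (((differentiableOn_thetaA.hasDerivAt_comp_sq hq).const_mul 2).mul
      (differentiableOn_thetaC.hasDerivAt_comp_sq hq))
    fun x hx ↦ thetaC_sq hx
  norm_num at h
  unfold eulerD
  linear_combination q / 2 * h

/-- The logarithmic derivatives of the three theta constants (`q^{1/4} C` in the last case). -/
noncomputable def logThetaA (q : ℂ) : ℂ := eulerD thetaA q / thetaA q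

/-- The logarithmic derivative of `thetaB` with respect to `log q`. -/
noncomputable def logThetaB (q : ℂ) : ℂ := eulerD thetaB q / thetaB q

/-- The logarithmic derivative of `thetaC` with respect to `log q`, shifted by `1 / 4`. -/
noncomputable def logThetaC (q : ℂ) : ℂ := 1 / 4 + eulerD thetaC q / thetaC q

lemma eulerD_thetaA (hq : ‖q‖ < 1) : eulerD thetaA q = thetaA q * logThetaA q :=
  (mul_div_cancel₀ _ (thetaA_ne_zero hq)).symm

lemma eulerD_thetaB (hq : ‖q‖ < 1) : eulerD thetaB q = thetaB q * logThetaB q :=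
  (mul_div_cancel₀ _ (thetaB_ne_zero hq)).symm

lemma eulerD_thetaC (hq : ‖q‖ < 1) : eulerD thetaC q = thetaC q * (logThetaC q - 1 / 4) := by
  rw [logThetaC, add_sub_cancel_left, mul_div_cancel₀ _ (thetaC_ne_zero hq)]

lemma differentiableOn_logThetaA : DifferentiableOn ℂ logThetaA (Metric.ball 0 1) :=
  differentiableOn_thetaA.eulerD.div differentiableOn_thetaA
    fun _ hq ↦ thetaA_ne_zero (by simpa using hq)

lemma differentiableOn_logThetaB : DifferentiableOn ℂ logThetaB (Metric.ball 0 1) :=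
  differentiableOn_thetaB.eulerD.div differentiableOn_thetaB
    fun _ hq ↦ thetaB_ne_zero (by simpa using hq)

lemma differentiableOn_logThetaC : DifferentiableOn ℂ logThetaC (Metric.ball 0 1) :=
  (differentiableOn_const _).add (differentiableOn_thetaC.eulerD.div differentiableOn_thetaC
    fun _ hq ↦ thetaC_ne_zero (by simpa using hq))

lemma thetaA_sq_mul_logThetaA (hq : ‖q‖ < 1) : thetaA q ^ 2 * logThetaA q =
    2 * thetaA (q ^ 2) ^ 2 * logThetaA (q ^ 2) +
      2 * q * thetaC (q ^ 2) ^ 2 * logThetaC (q ^ 2) := by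
  have h := thetaA_mul_eulerD hq
  have hq2 := norm_sq_lt_one hq
  rw [eulerD_thetaA hq, eulerD_thetaA hq2, eulerD_thetaC hq2] at h
  linear_combination h

lemma logThetaC_eq (hq : ‖q‖ < 1) : logThetaC q = logThetaA (q ^ 2) + logThetaC (q ^ 2) := by
  have h := thetaC_mul_eulerD hq
  have hq2 := norm_sq_lt_one hq
  rw [eulerD_thetaC hq, eulerD_thetaA hq2, eulerD_thetaC hq2] at h
  refine mul_left_cancel₀ (pow_ne_zero 2 (thetaC_ne_zero hq)) ?_
  linear_combination h + (1 / 4 - logThetaA (q ^ 2) - logThetaC (q ^ 2)) * thetaC_sq hq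

/-- `D log (θ₂ / θ₃) = θ₄⁴ / 4`. -/
lemma logThetaC_sub_logThetaA (hq : ‖q‖ < 1) :
    logThetaC q - logThetaA q = thetaB q ^ 4 / 4 := by
  -- The quotient is invariant under q ↦ q² and therefore equal to its value 1/4 at the origin.
  have key : (logThetaC q - logThetaA q) / thetaB q ^ 4 =
      (logThetaC 0 - logThetaA 0) / thetaB 0 ^ 4 := by
    refine eq_apply_zero_of_eq_sq (f := fun q ↦ (logThetaC q - logThetaA q) / thetaB q ^ 4)
      ?_ (fun q hq ↦ ?_) hq
    · exact ((differentiableOn_logThetaC.sub differentiableOn_logThetaA).div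
        (differentiableOn_thetaB.pow 4) fun _ hq ↦ pow_ne_zero 4
          (thetaB_ne_zero (by simpa using hq))).continuousOn.continuousAt ball_one_mem_nhds_zero
    · have hq2 := norm_sq_lt_one hq
      have h1 : thetaA q ^ 2 * (logThetaC q - logThetaA q) =
          thetaB q ^ 2 * (logThetaC (q ^ 2) - logThetaA (q ^ 2)) := by
        rw [mul_sub, thetaA_sq_mul_logThetaA hq, logThetaC_eq hq, thetaA_sq hq, thetaB_sq hq]
        ring
      have h2 : thetaB (q ^ 2) ^ 4 = thetaA q ^ 2 * thetaB q ^ 2 := by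
        rw [← mul_pow, thetaA_mul_thetaB hq]
        ring
      have hA := thetaA_ne_zero hq
      have hB := thetaB_ne_zero hq
      rw [h2]
      field_simp
      linear_combination h1
  rw [div_eq_iff (pow_ne_zero 4 (thetaB_ne_zero hq))] at key
  rw [key]
  simp [logThetaC, logThetaA, eulerD, thetaB_zero]
  ring

/-- A quarter of D applied to Jacobi's identity; the 1/4 inside `logThetaC` absorbs the derivative
of the factor q. -/
lemma eulerD_sub_thetaA_thetaB (hq : ‖q‖ < 1) :
    thetaA q ^ 4 * logThetaA q - thetaB q ^ 4 * logThetaB q = q * thetaC q ^ 4 * logThetaC q := by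
  have h := HasDerivAt.unique_of_eq_ball hq
    (((differentiableOn_thetaA.hasDerivAt_of_norm_lt hq).pow 4).sub
      ((differentiableOn_thetaB.hasDerivAt_of_norm_lt hq).pow 4))
    ((hasDerivAt_id q).mul ((differentiableOn_thetaC.hasDerivAt_of_norm_lt hq).pow 4))
    fun x hx ↦ thetaA_pow_four_sub hx
  have hA := eulerD_thetaA hq
  have hB := eulerD_thetaB hq
  have hC := eulerD_thetaC hq
  unfold eulerD at hA hB hC
  simp only [id, Pi.pow_apply] at h
  norm_num at h
  linear_combination q / 4 * h - thetaA q ^ 3 * hA + thetaB q ^ 3 * hB + q * thetaC q ^ 3 * hC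

/-- `D log (θ₂ / θ₄) = θ₃⁴ / 4`. -/
lemma logThetaC_sub_logThetaB (hq : ‖q‖ < 1) :
    logThetaC q - logThetaB q = thetaA q ^ 4 / 4 := by
  refine mul_left_cancel₀ (pow_ne_zero 4 (thetaB_ne_zero hq)) ?_
  linear_combination thetaA q ^ 4 * logThetaC_sub_logThetaA hq + eulerD_sub_thetaA_thetaB hq -
    logThetaC q * thetaA_pow_four_sub hq

lemma logThetaA_eq (hq : ‖q‖ < 1) : logThetaA q = logThetaB q + q * thetaC q ^ 4 / 4 := by
  linear_combination logThetaC_sub_logThetaB hq - logThetaC_sub_logThetaA hq +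
    thetaA_pow_four_sub hq / 4

lemma logThetaA_add_logThetaB (hq : ‖q‖ < 1) :
    logThetaA q + logThetaB q = 4 * logThetaB (q ^ 2) := by
  have hq2 := norm_sq_lt_one hq
  have h := HasDerivAt.unique_of_eq_ball hq
    ((differentiableOn_thetaA.hasDerivAt_of_norm_lt hq).mul
      (differentiableOn_thetaB.hasDerivAt_of_norm_lt hq))
    ((differentiableOn_thetaB.hasDerivAt_comp_sq hq).pow 2)
    fun x hx ↦ thetaA_mul_thetaB hx
  have hA := eulerD_thetaA hq
  have hB := eulerD_thetaB hq
  have hB2 := eulerD_thetaB hq2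
  unfold eulerD at hA hB hB2
  norm_num at h
  refine mul_left_cancel₀ (mul_ne_zero (thetaA_ne_zero hq) (thetaB_ne_zero hq)) ?_
  linear_combination q * h - thetaB q * hA - thetaA q * hB + 4 * thetaB (q ^ 2) * hB2 -
    4 * logThetaB (q ^ 2) * thetaA_mul_thetaB hq

lemma eulerD_logThetaA_eq (hq : ‖q‖ < 1) :
    eulerD logThetaA q = eulerD logThetaB q + q * thetaC q ^ 4 * logThetaC q := by
  have h := HasDerivAt.unique_of_eq_ball hq
    (differentiableOn_logThetaA.hasDerivAt_of_norm_lt hq)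
    ((differentiableOn_logThetaB.hasDerivAt_of_norm_lt hq).add
      (((hasDerivAt_id q).mul
        ((differentiableOn_thetaC.hasDerivAt_of_norm_lt hq).pow 4)).div_const 4))
    fun x hx ↦ logThetaA_eq hx
  have hC := eulerD_thetaC hq
  unfold eulerD at hC ⊢
  simp only [id, Pi.pow_apply] at h
  norm_num at h
  linear_combination q * h + q * thetaC q ^ 3 * hC

/-- D applied to `logThetaA_add_logThetaB`; the chain rule for q² turns the 4 into 8. -/
lemma eulerD_logThetaA_add (hq : ‖q‖ < 1) :
    eulerD logThetaA q + eulerD logThetaB q = 8 * eulerD logThetaB (q ^ 2) := by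
  have h := HasDerivAt.unique_of_eq_ball hq
    ((differentiableOn_logThetaA.hasDerivAt_of_norm_lt hq).add
      (differentiableOn_logThetaB.hasDerivAt_of_norm_lt hq))
    ((differentiableOn_logThetaB.hasDerivAt_comp_sq hq).const_mul 4)
    fun x hx ↦ logThetaA_add_logThetaB hx
  unfold eulerD
  linear_combination q * h

/-- A function on the disc with `f q = 4 f (q ^ 2)` that vanishes at the origin is zero. -/
lemma eq_zero_of_eq_four_mul_sq {f : ℂ → ℂ} (hf : DifferentiableAt ℂ f 0) (h0 : f 0 = 0)
    (h : ∀ q, ‖q‖ < 1 → f q = 4 * f (q ^ 2)) (hq : ‖q‖ < 1) : f q = 0 := by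
  have hn : ∀ n : ℕ, ‖q ^ 2 ^ n‖ < 1 ∧ f q = 4 ^ n * f (q ^ 2 ^ n) := by
    intro n
    induction n with
    | zero => simpa using hq
    | succ n ih =>
      refine ⟨?_, ?_⟩
      · rw [pow_succ, pow_mul]
        exact norm_sq_lt_one ih.1
      · rw [ih.2, h _ ih.1, pow_succ 4, pow_succ 2, pow_mul]
        ring
  have hO : f =O[nhds 0] fun q ↦ q := by simpa [h0] using hf.isBigO_sub
  have hO' := (Asymptotics.isBigO_refl (fun n : ℕ ↦ (4 : ℂ) ^ n) Filter.atTop).mul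
    (hO.comp_tendsto (tendsto_pow_two_pow_nhds_zero hq))
  -- With k = 2ⁿ the norm is k²‖q‖ᵏ, which tends to 0; as f = O(q) at the origin, this beats the
  -- factor 4ⁿ.
  have hlim : Filter.Tendsto (fun n : ℕ ↦ (4 : ℂ) ^ n * q ^ 2 ^ n) Filter.atTop (nhds 0) := by
    have h1 := (tendsto_pow_const_mul_const_pow_of_abs_lt_one 2 (r := ‖q‖) (by simpa)).comp
      (tendsto_pow_atTop_atTop_of_one_lt (one_lt_two (α := ℕ)))
    refine tendsto_zero_iff_norm_tendsto_zero.mpr (h1.congr fun n ↦ ?_)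
    simp only [Function.comp_apply, norm_mul, norm_pow, Complex.norm_ofNat]
    push_cast
    rw [← pow_mul, mul_comm n 2, pow_mul]
    norm_num
  refine tendsto_nhds_unique (f := fun n : ℕ ↦ (4 : ℂ) ^ n * f (q ^ 2 ^ n)) ?_
    (hO'.trans_tendsto hlim)
  simp only [← (hn _).2, tendsto_const_nhds]

/-- The differential equation satisfied by `D log θ₄`. -/
lemma eulerD_logThetaB (hq : ‖q‖ < 1) :
    eulerD logThetaB q = 2 * logThetaB q ^ 2 - q * thetaC q ^ 4 * thetaA q ^ 4 / 8 := by
  suffices eulerD logThetaB q - 2 * logThetaB q ^ 2 + q * thetaC q ^ 4 * thetaA q ^ 4 / 8 = 0 by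
    linear_combination this
  -- The defect of the equation takes at q four times its value at q². To check this, everything at
  -- q² is expressed through `logThetaB`, A, C at q.
  refine eq_zero_of_eq_four_mul_sq (f := fun q ↦
    eulerD logThetaB q - 2 * logThetaB q ^ 2 + q * thetaC q ^ 4 * thetaA q ^ 4 / 8)
    ?_ ?_ (fun q hq ↦ ?_) hq
  · exact (((differentiableOn_logThetaB.eulerD).sub ((differentiableOn_logThetaB.pow 2).const_mul
      2)).add (((differentiableOn_id.mul (differentiableOn_thetaC.pow 4)).mul
        (differentiableOn_thetaA.pow 4)).div_const 8)).differentiableAt ball_one_mem_nhds_zero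
  · simp [logThetaB, eulerD]
  · have hD := eulerD_logThetaA_eq hq
    have hD2 := eulerD_logThetaA_add hq
    have ha := logThetaA_eq hq
    have hb2 : logThetaB (q ^ 2) = (logThetaA q + logThetaB q) / 4 := by
      rw [logThetaA_add_logThetaB hq]
      ring
    have hc : logThetaC q = logThetaB q + thetaA q ^ 4 / 4 := by
      linear_combination logThetaC_sub_logThetaB hq
    have hC : (q ^ 2) * thetaC (q ^ 2) ^ 4 * thetaA (q ^ 2) ^ 4 =
        (q * thetaC q ^ 4) ^ 2 / 16 := by
      have h8 : thetaC q ^ 8 = (thetaC q ^ 2) ^ 4 := by ring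
      rw [mul_pow, ← pow_mul, h8, thetaC_sq hq]
      ring
    have hD3 : eulerD logThetaB (q ^ 2) =
        (2 * eulerD logThetaB q + q * thetaC q ^ 4 * logThetaC q) / 8 := by
      linear_combination hD / 8 - hD2 / 8
    simp only [hC, hD3, hb2, ha, hc]
    ring

/-- The differential equation satisfied by `D log θ₃`. -/
lemma eulerD_logThetaA (hq : ‖q‖ < 1) :
    eulerD logThetaA q = 2 * logThetaA q ^ 2 + q * thetaC q ^ 4 * thetaB q ^ 4 / 8 := by
  have hc : logThetaC q = logThetaB q + thetaA q ^ 4 / 4 := by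
    linear_combination logThetaC_sub_logThetaB hq
  have hB : thetaB q ^ 4 = thetaA q ^ 4 - q * thetaC q ^ 4 := by
    linear_combination -thetaA_pow_four_sub hq
  rw [eulerD_logThetaA_eq hq, eulerD_logThetaB hq, logThetaA_eq hq, hc, hB]
  ring

/-! ### Theta series of the character α ↦ α⁴ of ℤ[i] -/

/-- The moment series `∑ n ^ k q ^ n²`. -/
noncomputable def thetaMoment (k : ℕ) : ℂ → ℂ := thetaSeries (fun n ↦ (n : ℂ) ^ k) sqExponent

lemma thetaMoment_zero : thetaMoment 0 = thetaA := by
  unfold thetaMoment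
  congr 1

lemma eulerD_thetaMoment (k : ℕ) (hq : ‖q‖ < 1) :
    eulerD (thetaMoment k) q = thetaMoment (k + 2) q := by
  rw [eulerD, thetaMoment, isThetaExponent_sq.mul_deriv (polyBounded_pow k) hq, thetaMoment]
  congr 1
  ext n
  have : ((sqExponent n : ℤ) : ℂ) = (n : ℂ) ^ 2 := by
    rw [natCast_sqExponent]
    push_cast
    rfl
  rw [pow_add, ← this, Int.cast_natCast]

/-- With a = D log A, the moments are M₂ = A a and M₄ = A(a² + Da), so the left side is A²(Da - 2a²)
and `eulerD_logThetaA` finishes. -/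
lemma thetaMoment_identity (hq : ‖q‖ < 1) :
    thetaMoment 4 q * thetaMoment 0 q - 3 * thetaMoment 2 q ^ 2 =
      q * thetaA q ^ 2 * thetaB q ^ 4 * thetaC q ^ 4 / 8 := by
  have h2 (x : ℂ) (hx : ‖x‖ < 1) : thetaMoment 2 x = thetaA x * logThetaA x := by
    rw [← eulerD_thetaMoment 0 hx, thetaMoment_zero, eulerD_thetaA hx]
  have hd2 : DifferentiableOn ℂ (thetaMoment 2) (Metric.ball 0 1) :=
    isThetaExponent_sq.differentiableOn (polyBounded_pow 2)
  have h4 : thetaMoment 4 q = thetaA q * (logThetaA q ^ 2 + eulerD logThetaA q) := by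
    rw [← eulerD_thetaMoment 2 hq]
    have h := HasDerivAt.unique_of_eq_ball hq (hd2.hasDerivAt_of_norm_lt hq)
      ((differentiableOn_thetaA.hasDerivAt_of_norm_lt hq).mul
        (differentiableOn_logThetaA.hasDerivAt_of_norm_lt hq)) h2
    have hA := eulerD_thetaA hq
    unfold eulerD at hA ⊢
    linear_combination q * h + logThetaA q * hA
  rw [h4, h2 q hq, thetaMoment_zero, eulerD_logThetaA hq]
  ring

/-- The exponent `m² + n²`, i.e. the norm of the Gaussian integer `m + n i`. -/
def gaussNorm (p : ℤ × ℤ) : ℕ := sqExponent p.1 + sqExponent p.2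

lemma natCast_gaussNorm (p : ℤ × ℤ) : (gaussNorm p : ℤ) = p.1 ^ 2 + p.2 ^ 2 := by
  rw [gaussNorm, Nat.cast_add, natCast_sqExponent, natCast_sqExponent]

/-- The theta series of the Hecke character `α ↦ α⁴` of `ℚ(i)`, as an expression in theta
constants. -/
lemma hasSum_gauss_pow_four (hq : ‖q‖ < 1) :
    HasSum (fun p : ℤ × ℤ ↦ ((p.1 : ℂ) + p.2 * I) ^ 4 * q ^ gaussNorm p)
      (q * thetaA q ^ 2 * thetaB q ^ 4 * thetaC q ^ 4 / 4) := by
  have hA := isThetaExponent_sq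
  have hs (j k : ℕ) : HasSum (fun p : ℤ × ℤ ↦
      (p.1 : ℂ) ^ j * q ^ sqExponent p.1 * ((p.2 : ℂ) ^ k * q ^ sqExponent p.2))
      (thetaMoment j q * thetaMoment k q) := by
    rw [thetaMoment, thetaMoment, hA.mul_eq_tsum (polyBounded_pow j) hA (polyBounded_pow k) hq]
    exact (hA.summable_mul (polyBounded_pow j) hA (polyBounded_pow k) hq).hasSum
  -- Binomial expansion of (m + ni)⁴; the two imaginary terms M₃M₁ and M₁M₃ cancel, leaving 2(M₄M₀ -
  -- 3M₂²).
  have h := ((((hs 4 0).add (hs 0 4)).sub ((hs 2 2).mul_left 6)).add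
    ((hs 3 1).mul_left (4 * I))).sub ((hs 1 3).mul_left (4 * I))
  have hv : q * thetaA q ^ 2 * thetaB q ^ 4 * thetaC q ^ 4 / 4 =
      thetaMoment 4 q * thetaMoment 0 q + thetaMoment 0 q * thetaMoment 4 q -
        6 * (thetaMoment 2 q * thetaMoment 2 q) + 4 * I * (thetaMoment 3 q * thetaMoment 1 q) -
        4 * I * (thetaMoment 1 q * thetaMoment 3 q) := by
    linear_combination -2 * thetaMoment_identity hq
  rw [hv]
  refine h.congr_fun fun p ↦ ?_
  simp only [gaussNorm, pow_add]
  linear_combination q ^ sqExponent p.1 * q ^ sqExponent p.2 * ((p.2 : ℂ) ^ 4 * (I ^ 2 - 1) +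
    6 * (p.1 : ℂ) ^ 2 * (p.2 : ℂ) ^ 2 + 4 * (p.1 : ℂ) * (p.2 : ℂ) ^ 3 * I) * Complex.I_sq

lemma even_gaussNorm_iff (p : ℤ × ℤ) : Even (gaussNorm p) ↔ Even (p.1 + p.2) := by
  rw [← Int.even_coe_nat, natCast_gaussNorm]
  simp [parity_simps]

/-- Odd norms are the part odd in q, and q ↦ -q exchanges A and B. After duplication the result is
θ₂²θ₃⁴θ₄⁴ at nome q², the weight occurring in the moment integral. -/
lemma hasSum_gauss_pow_four_odd (hq : ‖q‖ < 1) :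
    HasSum (fun p : ℤ × ℤ ↦ if Even (p.1 + p.2) then 0 else
        ((p.1 : ℂ) + p.2 * I) ^ 4 * q ^ gaussNorm p)
      (q * thetaC (q ^ 2) ^ 2 * thetaA (q ^ 2) ^ 4 * thetaB (q ^ 2) ^ 4) := by
  have h := ((hasSum_gauss_pow_four hq).sub
    (hasSum_gauss_pow_four (q := -q) (by simpa using hq))).mul_left (1 / 2)
  rw [thetaA_neg, thetaB_neg, thetaC_neg] at h
  have h1 : thetaA q ^ 2 + thetaB q ^ 2 = 2 * thetaA (q ^ 2) ^ 2 := by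
    linear_combination thetaA_sq hq + thetaB_sq hq
  have h2 : thetaA q ^ 2 * thetaB q ^ 2 = thetaB (q ^ 2) ^ 4 := by
    rw [← mul_pow, thetaA_mul_thetaB hq]
    ring
  have h3 : thetaC q ^ 4 = 4 * thetaA (q ^ 2) ^ 2 * thetaC (q ^ 2) ^ 2 := by
    rw [show thetaC q ^ 4 = (thetaC q ^ 2) ^ 2 by ring, thetaC_sq hq]
    ring
  have hv : q * thetaC (q ^ 2) ^ 2 * thetaA (q ^ 2) ^ 4 * thetaB (q ^ 2) ^ 4 =
      1 / 2 * (q * thetaA q ^ 2 * thetaB q ^ 4 * thetaC q ^ 4 / 4 -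
        -q * thetaB q ^ 2 * thetaA q ^ 4 * thetaC q ^ 4 / 4) := by
    linear_combination -q / 8 * thetaC q ^ 4 * thetaA q ^ 2 * thetaB q ^ 2 * h1 -
      q / 4 * thetaC q ^ 4 * thetaA (q ^ 2) ^ 2 * h2 -
      q / 4 * thetaB (q ^ 2) ^ 4 * thetaA (q ^ 2) ^ 2 * h3
  rw [hv]
  refine h.congr_fun fun p ↦ ?_
  split_ifs with hp
  · rw [((even_gaussNorm_iff p).mpr hp).neg_pow]
    ring
  · rw [(Nat.not_even_iff_odd.mp ((even_gaussNorm_iff p).not.mpr hp)).neg_pow]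
    ring

end

/-! ### Theta constants on the half-plane and their modular transformations -/

open scoped MatrixGroups

/-- The nome `e^{πiτ}`. -/
noncomputable def nome (τ : ℂ) : ℂ := Complex.exp (Real.pi * I * τ)

lemma norm_nome_lt_one {τ : ℂ} (hτ : 0 < τ.im) : ‖nome τ‖ < 1 := by
  rw [nome, Complex.norm_exp, Real.exp_lt_one_iff]
  simp only [Complex.mul_re, Complex.mul_im, Complex.ofReal_re, Complex.ofReal_im, Complex.I_re,
    Complex.I_im]
  nlinarith [mul_pos Real.pi_pos hτ]

lemma nome_eq_qParam (τ : ℂ) : nome τ = Function.Periodic.qParam 2 τ := by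
  rw [nome, Function.Periodic.qParam]
  congr 1
  push_cast
  ring

lemma exists_nome_eq {q : ℂ} (hq : ‖q‖ < 1) (h0 : q ≠ 0) : ∃ τ : ℍ, nome τ = q := by
  refine ⟨⟨Function.Periodic.invQParam 2 q,
    Function.Periodic.im_invQParam_pos_of_norm_lt_one two_pos hq h0⟩, ?_⟩
  rw [nome_eq_qParam]
  exact Function.Periodic.qParam_right_inv two_ne_zero h0

lemma nome_pow_two (τ : ℂ) : nome τ ^ 2 = Function.Periodic.qParam 1 τ := by
  rw [nome, Function.Periodic.qParam, ← Complex.exp_nat_mul]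
  congr 1
  push_cast
  ring

/-- The theta constant `θ₂`. -/
noncomputable def theta2 (τ : ℂ) : ℂ := Complex.exp (Real.pi * I * τ / 4) * thetaC (nome τ)

/-- The theta constant `θ₃`. -/
noncomputable def theta3 (τ : ℂ) : ℂ := thetaA (nome τ)

/-- The theta constant `θ₄`. -/
noncomputable def theta4 (τ : ℂ) : ℂ := thetaB (nome τ)

lemma theta3_eq_jacobiTheta₂ (τ : ℂ) : theta3 τ = jacobiTheta₂ 0 τ := by
  refine tsum_congr fun n ↦ ?_
  have : ((sqExponent n : ℤ) : ℂ) = (n : ℂ) ^ 2 := by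
    rw [natCast_sqExponent]
    push_cast
    rfl
  rw [jacobiTheta₂_term, nome, ← Complex.exp_nat_mul, ← this, Pi.one_apply, one_mul,
    Int.cast_natCast]
  congr 1
  ring

lemma theta4_eq_jacobiTheta₂ (τ : ℂ) : theta4 τ = jacobiTheta₂ (1 / 2) τ := by
  refine tsum_congr fun n ↦ ?_
  have : ((sqExponent n : ℤ) : ℂ) = (n : ℂ) ^ 2 := by
    rw [natCast_sqExponent]
    push_cast
    rfl
  rw [jacobiTheta₂_term, nome, ← Complex.exp_nat_mul, ← this, Complex.exp_add,
    Int.cast_natCast]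
  congr 1
  · rw [show 2 * (Real.pi : ℂ) * I * n * (1 / 2) = n * (Real.pi * I) by ring,
      Complex.exp_int_mul, Complex.exp_pi_mul_I]
    beta_reduce
    rcases Int.even_or_odd n with h | h
    · rw [h.neg_one_zpow, (Int.natAbs_even.mpr h).neg_one_pow]
    · rw [h.neg_one_zpow, (Int.natAbs_odd.mpr h).neg_one_pow]
  · congr 1
    ring

lemma theta2_eq_jacobiTheta₂ (τ : ℂ) :
    theta2 τ = Complex.exp (Real.pi * I * τ / 4) * jacobiTheta₂ (τ / 2) τ := by
  rw [theta2]
  congr 1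
  refine tsum_congr fun n ↦ ?_
  have : ((pronicExponent n : ℤ) : ℂ) = (n : ℂ) ^ 2 + n := by
    rw [natCast_pronicExponent]
    push_cast
    rfl
  rw [Int.cast_natCast] at this
  rw [jacobiTheta₂_term, nome, ← Complex.exp_nat_mul, Pi.one_apply, one_mul, this]
  congr 1
  ring

lemma cpow_half_sq (z : ℂ) : (z ^ (1 / 2 : ℂ)) ^ 2 = z := by
  rw [one_div]
  exact_mod_cast Complex.cpow_nat_inv_pow z two_ne_zero

/-- Squaring the functional equation of `jacobiTheta₂` removes the choice of branch in (-iτ)^(1/2).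
-/
lemma theta3_S {τ : ℂ} (hτ : τ ≠ 0) : theta3 (-1 / τ) ^ 2 = -I * τ * theta3 τ ^ 2 := by
  have h := jacobiTheta₂_functional_equation 0 τ
  rw [← theta3_eq_jacobiTheta₂, zero_div, ← theta3_eq_jacobiTheta₂] at h
  have h0 : -I * τ ≠ 0 := by simp [hτ]
  rw [h]
  simp only [mul_pow, div_pow, cpow_half_sq]
  field_simp
  simp

lemma theta2_S {τ : ℂ} (hτ : τ ≠ 0) : theta2 (-1 / τ) ^ 2 = -I * τ * theta4 τ ^ 2 := by
  have h := jacobiTheta₂_functional_equation (1 / 2) τ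
  rw [show 1 / 2 / τ = -(-1 / τ / 2) by ring, jacobiTheta₂_neg_left, mul_assoc,
    show -(Real.pi : ℂ) * I * (1 / 2) ^ 2 / τ = Real.pi * I * (-1 / τ) / 4 by ring,
    ← theta2_eq_jacobiTheta₂, ← theta4_eq_jacobiTheta₂] at h
  have h0 : -I * τ ≠ 0 := by simp [hτ]
  rw [h]
  simp only [mul_pow, div_pow, cpow_half_sq]
  field_simp

lemma theta4_S {τ : ℂ} (hτ : τ ≠ 0) : theta4 (-1 / τ) ^ 2 = -I * τ * theta2 τ ^ 2 := by
  have h := theta2_S (τ := -1 / τ) (by simp [hτ])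
  rw [show -1 / (-1 / τ) = τ by field_simp] at h
  rw [h]
  field_simp
  simp

lemma nome_add_one (τ : ℂ) : nome (τ + 1) = -nome τ := by
  rw [nome, nome, mul_add, mul_one, Complex.exp_add, Complex.exp_pi_mul_I, mul_neg_one]

lemma theta3_T (τ : ℂ) : theta3 (τ + 1) = theta4 τ := by
  rw [theta3, theta4, nome_add_one, thetaA_neg]

lemma theta4_T (τ : ℂ) : theta4 (τ + 1) = theta3 τ := by
  rw [theta3, theta4, nome_add_one, thetaB_neg]

lemma theta2_pow_eight (τ : ℂ) : theta2 τ ^ 8 = nome τ ^ 2 * thetaC (nome τ) ^ 8 := by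
  rw [theta2, mul_pow, nome, ← Complex.exp_nat_mul, ← Complex.exp_nat_mul]
  congr 2
  push_cast
  ring

/-- Translation multiplies θ₂ by an eighth root of unity, hence the eighth power. -/
lemma theta2_T_pow_eight (τ : ℂ) : theta2 (τ + 1) ^ 8 = theta2 τ ^ 8 := by
  rw [theta2_pow_eight, theta2_pow_eight, nome_add_one, thetaC_neg, neg_sq]

lemma differentiableAt_comp_nome {f : ℂ → ℂ} (hf : DifferentiableOn ℂ f (Metric.ball 0 1)) {τ : ℂ}
    (hτ : 0 < τ.im) : DifferentiableAt ℂ (fun τ ↦ f (nome τ)) τ :=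
  (hf.differentiableAt (ball_one_mem_nhds (norm_nome_lt_one hτ))).comp τ
    (by unfold nome; fun_prop)

lemma differentiableAt_theta3 {τ : ℂ} (hτ : 0 < τ.im) : DifferentiableAt ℂ theta3 τ :=
  differentiableAt_comp_nome differentiableOn_thetaA hτ

lemma differentiableAt_theta4 {τ : ℂ} (hτ : 0 < τ.im) : DifferentiableAt ℂ theta4 τ :=
  differentiableAt_comp_nome differentiableOn_thetaB hτ

lemma differentiableAt_theta2 {τ : ℂ} (hτ : 0 < τ.im) : DifferentiableAt ℂ theta2 τ :=
  .mul (by fun_prop) (differentiableAt_comp_nome differentiableOn_thetaC hτ)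

open UpperHalfPlane in
lemma tendsto_nome_atImInfty :
    Filter.Tendsto (fun τ : ℍ ↦ nome τ) atImInfty (nhds 0) := by
  simp only [nome_eq_qParam]
  exact qParam_tendsto_atImInfty two_pos

open UpperHalfPlane in
lemma tendsto_theta2_pow_eight :
    Filter.Tendsto (fun τ : ℍ ↦ theta2 τ ^ 8) atImInfty (nhds 0) := by
  simp only [theta2_pow_eight]
  simpa using (tendsto_nome_atImInfty.pow 2).mul
    ((continuousAt_thetaC_zero.tendsto.comp tendsto_nome_atImInfty).pow 8)

open UpperHalfPlane in
lemma tendsto_theta3 : Filter.Tendsto (fun τ : ℍ ↦ theta3 τ) atImInfty (nhds 1) := by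
  rw [← thetaA_zero]
  exact continuousAt_thetaA_zero.tendsto.comp tendsto_nome_atImInfty

open UpperHalfPlane in
lemma tendsto_theta4 : Filter.Tendsto (fun τ : ℍ ↦ theta4 τ) atImInfty (nhds 1) := by
  rw [← thetaB_zero]
  exact continuousAt_thetaB_zero.tendsto.comp tendsto_nome_atImInfty

/-! ### Level-one modular forms built from theta constants -/

lemma slash_S_eq {F : ℂ → ℂ} {k : ℕ} (h : ∀ τ : ℂ, τ ≠ 0 → F (-1 / τ) = τ ^ k * F τ) :
    (fun τ : ℍ ↦ F τ) ∣[(k : ℤ)] ModularGroup.S = fun τ : ℍ ↦ F τ := by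
  ext z
  rw [ModularForm.SL_slash_apply, UpperHalfPlane.modular_S_smul]
  rw [ModularGroup.denom_S, zpow_neg, zpow_natCast]
  change F (-(z : ℂ))⁻¹ * ((z : ℂ) ^ k)⁻¹ = F z
  rw [show (-(z : ℂ))⁻¹ = -1 / z by rw [neg_div, one_div, inv_neg], h z z.ne_zero]
  have := z.ne_zero
  field_simp

lemma slash_T_eq {F : ℂ → ℂ} {k : ℕ} (h : ∀ τ : ℂ, F (τ + 1) = F τ) :
    (fun τ : ℍ ↦ F τ) ∣[(k : ℤ)] ModularGroup.T = fun τ : ℍ ↦ F τ := by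
  ext z
  rw [ModularForm.SL_slash_apply, ModularGroup.denom_apply, UpperHalfPlane.modular_T_smul]
  simpa [ModularGroup.coe_T, add_comm] using h z

/-- The level one modular form attached to a periodic function with the right behaviour under
inversion. -/
noncomputable def levelOneForm {F : ℂ → ℂ} {k : ℕ} {a : ℂ}
    (hS : ∀ τ : ℂ, τ ≠ 0 → F (-1 / τ) = τ ^ k * F τ) (hT : ∀ τ : ℂ, F (τ + 1) = F τ)
    (hF : ∀ τ : ℂ, 0 < τ.im → DifferentiableAt ℂ F τ)
    (hlim : Filter.Tendsto (fun τ : ℍ ↦ F τ) UpperHalfPlane.atImInfty (nhds a)) :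
    ModularForm 𝒮ℒ k where
  toFun τ := F τ
  slash_action_eq' A hA := by
    obtain ⟨A, rfl⟩ := hA
    exact SlashInvariantForm.slash_action_generators_SL2Z (slash_S_eq hS) (slash_T_eq hT) A
  holo' := by
    rw [UpperHalfPlane.mdifferentiable_iff]
    refine .congr (fun z hz ↦ (hF z hz).differentiableWithinAt) fun z hz ↦ ?_
    simp [UpperHalfPlane.ofComplex_apply_of_im_pos hz]
  bdd_at_cusps' hc := by
    rw [Subgroup.IsArithmetic.isCusp_iff_isCusp_SL2Z] at hc
    rw [OnePoint.isBoundedAt_iff_forall_SL2Z hc]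
    intro γ _
    -- Invariance under SL₂(ℤ) reduces every cusp to the limit at i∞.
    rw [SlashInvariantForm.slash_action_generators_SL2Z (slash_S_eq hS) (slash_T_eq hT)]
    exact hlim.isBigO_one ℝ

/-- The level one cusp form attached to a periodic function with the right behaviour under
inversion. -/
noncomputable def levelOneCuspForm {F : ℂ → ℂ} {k : ℕ}
    (hS : ∀ τ : ℂ, τ ≠ 0 → F (-1 / τ) = τ ^ k * F τ) (hT : ∀ τ : ℂ, F (τ + 1) = F τ)
    (hF : ∀ τ : ℂ, 0 < τ.im → DifferentiableAt ℂ F τ)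
    (hlim : Filter.Tendsto (fun τ : ℍ ↦ F τ) UpperHalfPlane.atImInfty (nhds 0)) :
    CuspForm 𝒮ℒ k where
  toFun τ := F τ
  slash_action_eq' := (levelOneForm hS hT hF hlim).slash_action_eq'
  holo' := (levelOneForm hS hT hF hlim).holo'
  zero_at_cusps' hc := by
    rw [Subgroup.IsArithmetic.isCusp_iff_isCusp_SL2Z] at hc
    rw [OnePoint.isZeroAt_iff_forall_SL2Z hc]
    intro γ _
    rw [SlashInvariantForm.slash_action_generators_SL2Z (slash_S_eq hS) (slash_T_eq hT)]
    exact hlim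

lemma neg_I_mul_pow_four (τ : ℂ) : (-I * τ) ^ 4 = τ ^ 4 := by
  rw [mul_pow, neg_pow, Complex.I_pow_four]
  norm_num

lemma theta2_S_pow_eight {τ : ℂ} (hτ : τ ≠ 0) : theta2 (-1 / τ) ^ 8 = τ ^ 4 * theta4 τ ^ 8 := by
  rw [show theta2 (-1 / τ) ^ 8 = (theta2 (-1 / τ) ^ 2) ^ 4 by ring, theta2_S hτ, mul_pow,
    neg_I_mul_pow_four]
  ring

lemma theta3_S_pow_eight {τ : ℂ} (hτ : τ ≠ 0) : theta3 (-1 / τ) ^ 8 = τ ^ 4 * theta3 τ ^ 8 := by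
  rw [show theta3 (-1 / τ) ^ 8 = (theta3 (-1 / τ) ^ 2) ^ 4 by ring, theta3_S hτ, mul_pow,
    neg_I_mul_pow_four]
  ring

lemma theta4_S_pow_eight {τ : ℂ} (hτ : τ ≠ 0) : theta4 (-1 / τ) ^ 8 = τ ^ 4 * theta2 τ ^ 8 := by
  rw [show theta4 (-1 / τ) ^ 8 = (theta4 (-1 / τ) ^ 2) ^ 4 by ring, theta4_S hτ, mul_pow,
    neg_I_mul_pow_four]
  ring

open UpperHalfPlane in
lemma E₄_tendsto : Filter.Tendsto (fun τ : ℍ ↦ ModularForm.E₄ τ) atImInfty (nhds 1) := by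
  have h1 := ModularFormClass.analyticAt_cuspFunction_zero ModularForm.E₄ one_pos
    (by simp : (1 : ℝ) ∈ (𝒮ℒ).strictPeriods)
  have h2 : cuspFunction 1 (ModularForm.E₄ : ℍ → ℂ) 0 = 1 := by
    have := EisensteinSeries.E_qExpansion_coeff_zero (k := 4) (by norm_num) (by decide)
    rw [qExpansion_coeff] at this
    simpa using this
  have h3 := h1.continuousAt.tendsto.comp (qParam_tendsto_atImInfty one_pos)
  rw [h2] at h3
  refine h3.congr fun τ ↦ ?_
  exact SlashInvariantFormClass.eq_cuspFunction ModularForm.E₄ τ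
    (by simp : (1 : ℝ) ∈ (𝒮ℒ).strictPeriods) one_ne_zero

open UpperHalfPlane in
/-- Jacobi's formula `θ₂⁸ + θ₃⁸ + θ₄⁸ = 2 E₄`. -/
lemma theta_pow_eight_sum (τ : ℍ) :
    theta2 τ ^ 8 + theta3 τ ^ 8 + theta4 τ ^ 8 = 2 * ModularForm.E₄ τ := by
  have hlim : Filter.Tendsto
      (fun τ : ℍ ↦ theta2 τ ^ 8 + theta3 τ ^ 8 + theta4 τ ^ 8) atImInfty (nhds 2) := by
    convert (tendsto_theta2_pow_eight.add (tendsto_theta3.pow 8)).add (tendsto_theta4.pow 8)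
      using 2
    norm_num
  let f := levelOneForm (F := fun τ ↦ theta2 τ ^ 8 + theta3 τ ^ 8 + theta4 τ ^ 8) (k := 4)
    (fun τ hτ ↦ by
      rw [theta2_S_pow_eight hτ, theta3_S_pow_eight hτ, theta4_S_pow_eight hτ]
      ring)
    (fun τ ↦ by
      rw [theta2_T_pow_eight, theta3_T, theta4_T]
      ring)
    (fun τ hτ ↦ (((differentiableAt_theta2 hτ).pow 8).add ((differentiableAt_theta3 hτ).pow 8)).add
      ((differentiableAt_theta4 hτ).pow 8)) hlim
  -- Weight 4 is one-dimensional, so the sum is a multiple of E₄; the limits 2 and 1 at i∞ fix the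
  -- factor.
  obtain ⟨v, hv, hspan⟩ := rank_eq_one_iff.mp ModularForm.levelOne_weight_four_rank_one
  obtain ⟨a, ha⟩ := hspan ModularForm.E₄
  obtain ⟨b, hb⟩ := hspan f
  have ha0 : a ≠ 0 := by
    rintro rfl
    exact EisensteinSeries.E_ne_zero (by norm_num) (by decide) (ha.symm.trans (zero_smul _ _))
  have hfE (τ : ℍ) : theta2 τ ^ 8 + theta3 τ ^ 8 + theta4 τ ^ 8 =
      b / a * ModularForm.E₄ τ := by
    have h1 : a * v τ = ModularForm.E₄ τ := by rw [← ha]; rfl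
    have h2 : b * v τ = theta2 τ ^ 8 + theta3 τ ^ 8 + theta4 τ ^ 8 :=
      congrArg (fun g : ModularForm _ _ ↦ g τ) hb
    rw [← h1, ← h2]
    field_simp
  have hba : 2 = b / a * 1 := tendsto_nhds_unique (hlim.congr hfE) (E₄_tendsto.const_mul (b / a))
  rw [hfE τ, hba, mul_one]

/-! ### Euler products and the eta quotient -/

/-- The Euler product `∏ (1 - q ^ n)`. -/
noncomputable def eulerProd (q : ℂ) : ℂ := ∏' n : ℕ, (1 - q ^ (n + 1))

lemma differentiableOn_eulerProd : DifferentiableOn ℂ eulerProd (Metric.ball 0 1) :=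
  ModularForm.differentiableOn_tprod_one_sub_pow

lemma eulerProd_zero : eulerProd 0 = 1 := by simp [eulerProd]

lemma eulerProd_ne_zero {q : ℂ} (hq : ‖q‖ < 1) : eulerProd q ≠ 0 := by
  simp only [eulerProd, sub_eq_add_neg]
  refine tprod_one_add_ne_zero_of_summable (f := fun n ↦ -q ^ (n + 1)) (fun n h ↦ ?_) ?_
  · have h1 : q ^ (n + 1) = 1 := by linear_combination -h
    have h2 : ‖q‖ ^ (n + 1) = 1 := by rw [← norm_pow, h1, norm_one]
    exact (pow_lt_one₀ (norm_nonneg _) hq n.succ_ne_zero).ne h2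
  · simpa [summable_nat_add_iff 1] using summable_geometric_of_lt_one (norm_nonneg _) hq

lemma eta_eq (τ : ℂ) : ModularForm.eta τ =
    Function.Periodic.qParam 24 τ * eulerProd (Function.Periodic.qParam 1 τ) := rfl

open UpperHalfPlane in
-- The eighth power is a cusp form of weight 12 and level one, and those are the multiples of Δ =
-- η²⁴.
lemma theta_prod_pow_eight_eq_eta : ∃ c : ℂ, ∀ τ : ℍ,
    (theta2 τ * theta3 τ * theta4 τ) ^ 8 = c * ModularForm.eta τ ^ 24 := by
  let f := levelOneCuspForm (F := fun τ ↦ (theta2 τ * theta3 τ * theta4 τ) ^ 8) (k := 12)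
    (fun τ hτ ↦ by
      simp only [mul_pow]
      rw [theta2_S_pow_eight hτ, theta3_S_pow_eight hτ, theta4_S_pow_eight hτ]
      ring)
    (fun τ ↦ by
      simp only [mul_pow]
      rw [theta2_T_pow_eight, theta3_T, theta4_T]
      ring)
    (fun τ hτ ↦ (((differentiableAt_theta2 hτ).mul (differentiableAt_theta3 hτ)).mul
      (differentiableAt_theta4 hτ)).pow 8) (by
      simp only [mul_pow]
      simpa using (tendsto_theta2_pow_eight.mul (tendsto_theta3.pow 8)).mul
        (tendsto_theta4.pow 8))
  obtain ⟨c, hc⟩ := CuspForm.exists_smul_discriminant_of_weight_eq_twelve f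
  exact ⟨c, fun τ ↦ (congrArg (fun g : CuspForm _ _ ↦ g τ) hc).symm⟩

lemma theta_prod_pow_eight {q : ℂ} (hq : ‖q‖ < 1) :
    (thetaA q * thetaB q * thetaC q) ^ 8 = 256 * eulerProd (q ^ 2) ^ 24 := by
  obtain ⟨c, hc⟩ := theta_prod_pow_eight_eq_eta
  have hE2 : DifferentiableOn ℂ (fun q ↦ eulerProd (q ^ 2)) (Metric.ball 0 1) := fun q hq ↦
    (differentiableOn_eulerProd.hasDerivAt_comp_sq
      (by simpa using hq)).differentiableAt.differentiableWithinAt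
  have hq' {q : ℂ} (hq : ‖q‖ < 1) (h0 : q ≠ 0) :
      (thetaA q * thetaB q * thetaC q) ^ 8 = c * eulerProd (q ^ 2) ^ 24 := by
    obtain ⟨τ, rfl⟩ := exists_nome_eq hq h0
    have h := hc τ
    have h1 : Function.Periodic.qParam 24 (τ : ℂ) ^ 24 = nome τ ^ 2 := by
      rw [nome_pow_two, Function.Periodic.qParam, Function.Periodic.qParam, ← Complex.exp_nat_mul]
      congr 1
      push_cast
      ring
    rw [mul_pow, mul_pow, theta2_pow_eight, eta_eq, mul_pow, ← nome_pow_two, h1, theta3,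
      theta4] at h
    refine mul_left_cancel₀ (pow_ne_zero 2 h0) ?_
    linear_combination h
  -- `hq'` excludes q = 0, but both sides are continuous there: (1 · 1 · 2)⁸ = c.
  have hc' : (256 : ℂ) = c := by
    have hl := (((differentiableOn_thetaA.mul differentiableOn_thetaB).mul
      differentiableOn_thetaC).pow 8).continuousOn.continuousAt ball_one_mem_nhds_zero
    have hr := ((hE2.pow 24).const_mul c).continuousOn.continuousAt ball_one_mem_nhds_zero
    have := (hl.eventuallyEq_nhds_iff_eventuallyEq_nhdsNE hr).mp (by
      filter_upwards [self_mem_nhdsWithin, mem_nhdsWithin_of_mem_nhds ball_one_mem_nhds_zero]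
        with q h0 hq using hq' (by simpa using hq) h0)
    have := this.eq_of_nhds
    simp only [Pi.mul_apply, Pi.pow_apply, thetaA_zero, thetaB_zero, thetaC_zero] at this
    norm_num [eulerProd_zero] at this
    exact this
  rcases eq_or_ne q 0 with rfl | h0
  · simp only [thetaA_zero, thetaB_zero, thetaC_zero]
    norm_num [eulerProd_zero]
  · rw [hq' hq h0, hc']

/-- A continuous function on the disc whose values are roots of unity is constant. -/
lemma eq_one_of_pow_eq_one {f : ℂ → ℂ} (hf : ContinuousOn f (Metric.ball 0 1)) {n : ℕ}
    (hn : n ≠ 0) (h : ∀ q, ‖q‖ < 1 → f q ^ n = 1) (h0 : f 0 = 1) {q : ℂ} (hq : ‖q‖ < 1) :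
    f q = 1 := by
  have hfin : ({z : ℂ | z ^ n = 1} : Set ℂ).Finite := by
    refine (Polynomial.nthRoots n (1 : ℂ)).toFinset.finite_toSet.subset fun z hz ↦ ?_
    simpa [Polynomial.mem_nthRoots (Nat.pos_of_ne_zero hn)] using hz
  have := (convex_ball (0 : ℂ) 1).isPreconnected.constant_of_mapsTo (T := {z : ℂ | z ^ n = 1})
    hfin.isDiscrete hf (fun q hq ↦ h q (by simpa using hq))
    (show q ∈ Metric.ball (0 : ℂ) 1 by simpa using hq) zero_mem_ball_one
  rw [this, h0]

lemma exists_sq_eq_of_norm_lt_one {q : ℂ} (hq : ‖q‖ < 1) : ∃ r : ℂ, ‖r‖ < 1 ∧ r ^ 2 = q := by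
  obtain ⟨r, hr⟩ := IsAlgClosed.exists_pow_nat_eq q two_pos
  refine ⟨r, ?_, hr⟩
  rw [← hr, norm_pow] at hq
  exact (pow_lt_one_iff_of_nonneg (norm_nonneg _) two_ne_zero).mp hq

/-- Gauss's product for `∑ (-1) ^ n q ^ n²`. -/
lemma thetaB_mul_eulerProd {q : ℂ} (hq : ‖q‖ < 1) :
    thetaB q * eulerProd (q ^ 2) = eulerProd q ^ 2 := by
  -- Working at a square root r lets `theta_prod_pow_eight` at r and r² be compared: with E the
  -- Euler product, the square of the first relation divided by the second gives
  -- (B(r²)E(r⁴)/E(r²)²)²⁴ = 1.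
  obtain ⟨r, hr, rfl⟩ := exists_sq_eq_of_norm_lt_one hq
  have hcomp {f : ℂ → ℂ} (hf : DifferentiableOn ℂ f (Metric.ball 0 1)) :
      DifferentiableOn ℂ (fun q ↦ f (q ^ 2)) (Metric.ball 0 1) := fun q hq ↦
    (hf.hasDerivAt_comp_sq (by simpa using hq)).differentiableAt.differentiableWithinAt
  have key := eq_one_of_pow_eq_one (n := 24) (q := r)
    (f := fun q ↦ thetaB (q ^ 2) * eulerProd ((q ^ 2) ^ 2) / eulerProd (q ^ 2) ^ 2) ?_ (by norm_num)
    (fun q hq ↦ ?_) ?_ hr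
  · rwa [div_eq_one_iff_eq (pow_ne_zero 2 (eulerProd_ne_zero hq))] at key
  · exact ((hcomp (differentiableOn_thetaB.mul (hcomp differentiableOn_eulerProd))).div
      ((hcomp differentiableOn_eulerProd).pow 2) fun q hq ↦ pow_ne_zero 2
        (eulerProd_ne_zero (norm_sq_lt_one (by simpa using hq)))).continuousOn
  · have hq2 := norm_sq_lt_one hq
    have h1 := theta_prod_pow_eight hq
    have h2 := theta_prod_pow_eight hq2
    have hE := eulerProd_ne_zero hq2
    have hB := thetaB_ne_zero hq2
    have hC := thetaC_ne_zero hq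
    rw [thetaA_mul_thetaB hq] at h1
    have h3 : thetaA (q ^ 2) * thetaB (q ^ 2) * thetaC (q ^ 2) =
        thetaB (q ^ 2) * thetaC q ^ 2 / 2 := by
      rw [thetaC_sq hq]
      ring
    rw [h3] at h2
    rw [div_pow, div_eq_one_iff_eq (pow_ne_zero _ (pow_ne_zero 2 hE))]
    have hne : thetaB (q ^ 2) ^ 8 * thetaC q ^ 16 ≠ 0 :=
      mul_ne_zero (pow_ne_zero _ hB) (pow_ne_zero _ hC)
    refine mul_left_cancel₀ hne ?_
    linear_combination eulerProd ((q ^ 2) ^ 2) ^ 24 * ((thetaB (q ^ 2) ^ 2 * thetaC q) ^ 8 +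
      256 * eulerProd (q ^ 2) ^ 24) * h1 - 256 * eulerProd (q ^ 2) ^ 48 * h2
  · simp [thetaB_zero, eulerProd_zero]

lemma thetaA_mul_eulerProd {q : ℂ} (hq : ‖q‖ < 1) :
    thetaA q * eulerProd q ^ 2 * eulerProd (q ^ 4) ^ 2 = eulerProd (q ^ 2) ^ 5 := by
  have hq2 := norm_sq_lt_one hq
  have h1 := thetaB_mul_eulerProd hq
  have h2 := thetaB_mul_eulerProd hq2
  rw [← pow_mul] at h2
  norm_num at h2
  rw [← h1]
  linear_combination eulerProd (q ^ 2) * eulerProd (q ^ 4) ^ 2 * thetaA_mul_thetaB hq +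
    eulerProd (q ^ 2) * (thetaB (q ^ 2) * eulerProd (q ^ 4) + eulerProd (q ^ 2) ^ 2) * h2

/-- Jacobi's θ₂θ₃θ₄ = 2η³: the eighth root of `theta_prod_pow_eight`, with the root of unity fixed
at q = 0. -/
lemma thetaA_mul_thetaB_mul_thetaC {q : ℂ} (hq : ‖q‖ < 1) :
    thetaA q * thetaB q * thetaC q = 2 * eulerProd (q ^ 2) ^ 3 := by
  have hcomp : DifferentiableOn ℂ (fun q ↦ eulerProd (q ^ 2)) (Metric.ball 0 1) := fun q hq ↦
    (differentiableOn_eulerProd.hasDerivAt_comp_sq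
      (by simpa using hq)).differentiableAt.differentiableWithinAt
  have hne {q : ℂ} (hq : ‖q‖ < 1) : 2 * eulerProd (q ^ 2) ^ 3 ≠ 0 :=
    mul_ne_zero two_ne_zero (pow_ne_zero 3 (eulerProd_ne_zero (norm_sq_lt_one hq)))
  have key := eq_one_of_pow_eq_one (n := 8) (q := q)
    (f := fun q ↦ thetaA q * thetaB q * thetaC q / (2 * eulerProd (q ^ 2) ^ 3)) ?_ (by norm_num)
    (fun q hq ↦ ?_) ?_ hq
  · rwa [div_eq_one_iff_eq (hne hq)] at key
  · exact (((differentiableOn_thetaA.mul differentiableOn_thetaB).mul differentiableOn_thetaC).div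
      ((hcomp.pow 3).const_mul 2) fun q hq ↦ hne (by simpa using hq)).continuousOn
  · rw [div_pow, div_eq_one_iff_eq (pow_ne_zero _ (hne hq)), theta_prod_pow_eight hq]
    ring
  · simp [thetaA_zero, thetaB_zero, thetaC_zero, eulerProd_zero]

lemma eulerProd_quotient {q : ℂ} (hq : ‖q‖ < 1) :
    eulerProd q ^ 4 * eulerProd (q ^ 2) ^ 2 * eulerProd (q ^ 4) ^ 4 =
      thetaA q ^ 2 * thetaB q ^ 4 * thetaC q ^ 4 / 16 := by
  have hA := thetaA_ne_zero hq
  have hE := eulerProd_ne_zero (norm_sq_lt_one hq)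
  have h1 := thetaA_mul_eulerProd hq
  have h2 := thetaA_mul_thetaB_mul_thetaC hq
  refine mul_left_cancel₀ (pow_ne_zero 2 hA) ?_
  calc _ = (thetaA q * eulerProd q ^ 2 * eulerProd (q ^ 4) ^ 2) ^ 2 * eulerProd (q ^ 2) ^ 2 := by
        ring
    _ = (2 * eulerProd (q ^ 2) ^ 3) ^ 4 / 16 := by
        rw [h1]
        ring
    _ = _ := by
        rw [← h2]
        ring

lemma etaQuotientG_eq (τ : ℍ) : etaQuotientG τ =
    Function.Periodic.qParam 1 τ * thetaA (Function.Periodic.qParam 1 τ) ^ 2 *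
      thetaB (Function.Periodic.qParam 1 τ) ^ 4 * thetaC (Function.Periodic.qParam 1 τ) ^ 4 / 16 := by
  have h (k : ℕ) : Function.Periodic.qParam 1 (k * (τ : ℂ)) =
      Function.Periodic.qParam 1 (τ : ℂ) ^ k := by
    rw [Function.Periodic.qParam, Function.Periodic.qParam, ← Complex.exp_nat_mul]
    congr 1
    ring
  have h2 := h 2
  have h4 := h 4
  -- The leading exponents add up to (4 + 2·2 + 4·4)/24 = 1.
  have h24 : Function.Periodic.qParam 24 (τ : ℂ) ^ 4 *
      Function.Periodic.qParam 24 (2 * (τ : ℂ)) ^ 2 *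
      Function.Periodic.qParam 24 (4 * (τ : ℂ)) ^ 4 = Function.Periodic.qParam 1 (τ : ℂ) := by
    simp only [Function.Periodic.qParam, ← Complex.exp_nat_mul, ← Complex.exp_add]
    congr 1
    push_cast
    ring
  have hq : ‖Function.Periodic.qParam 1 (τ : ℂ)‖ < 1 :=
    Function.Periodic.norm_qParam_lt_one one_pos τ.im_pos
  have hE := eulerProd_quotient hq
  norm_num at h2 h4
  rw [etaQuotientG, eta_eq, eta_eq, eta_eq, h2, h4]
  linear_combination Function.Periodic.qParam 1 (τ : ℂ) * hE + eulerProd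
    (Function.Periodic.qParam 1 (τ : ℂ)) ^ 4 * eulerProd (Function.Periodic.qParam 1 (τ : ℂ) ^ 2) ^ 2
    * eulerProd (Function.Periodic.qParam 1 (τ : ℂ) ^ 4) ^ 4 * h24

/-! ### The point τ = i and Eisenstein sums over ℤ[i] -/

lemma theta3_pow_four (τ : ℂ) (hτ : 0 < τ.im) :
    theta3 τ ^ 4 = theta2 τ ^ 4 + theta4 τ ^ 4 := by
  have h : theta2 τ ^ 4 = nome τ * thetaC (nome τ) ^ 4 := by
    rw [theta2, mul_pow, nome, ← Complex.exp_nat_mul]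
    congr 2
    push_cast
    ring
  rw [h]
  unfold theta3 theta4
  linear_combination thetaA_pow_four_sub (norm_nome_lt_one hτ)

/-- As i is fixed by τ ↦ -1/τ, θ₂² = θ₄² there; insert this in Jacobi's identity. -/
lemma theta3_I_pow_four : theta3 I ^ 4 = 2 * theta4 I ^ 4 := by
  have h := theta2_S Complex.I_ne_zero
  rw [show -1 / I = I by rw [div_eq_iff Complex.I_ne_zero, Complex.I_mul_I],
    show -I * I = 1 by rw [neg_mul, Complex.I_mul_I, neg_neg], one_mul] at h
  rw [theta3_pow_four I (by simp)]
  linear_combination (theta2 I ^ 2 + theta4 I ^ 2) * h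

lemma E₄_I : ModularForm.E₄ UpperHalfPlane.I = 3 / 4 * theta3 I ^ 8 := by
  have h := theta_pow_eight_sum UpperHalfPlane.I
  rw [UpperHalfPlane.coe_I] at h
  have h1 := theta3_I_pow_four
  have h2 := theta3_pow_four I (by simp)
  have h3 : theta2 I ^ 4 = theta4 I ^ 4 := by linear_combination h1 - h2
  linear_combination -h / 2 + (theta2 I ^ 4 + theta4 I ^ 4) / 2 * h3 -
    (theta3 I ^ 4 + 2 * theta4 I ^ 4) / 4 * h1

/-- The lattice sum is 2ζ(4)E₄(i), with ζ(4) = π⁴/90 and E₄(i) = ¾ θ₃(i)⁸. -/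
lemma hasSum_gauss_inv_pow_four :
    HasSum (fun p : ℤ × ℤ ↦ (((p.1 : ℂ) + p.2 * I) ^ 4)⁻¹)
      (Real.pi ^ 4 / 60 * theta3 I ^ 8) := by
  have h1 := tsum_eisSummand_eq_riemannZeta_mul_eisensteinSeries (k := 4) (by norm_num)
    UpperHalfPlane.I
  have h2 : eisensteinSeries (N := 1) 0 (4 : ℕ) UpperHalfPlane.I =
      2 * ModularForm.E₄ UpperHalfPlane.I := by
    rw [show ModularForm.E₄ UpperHalfPlane.I = (1 / 2 : ℂ) •
      EisensteinSeries.eisensteinSeriesSIF (N := 1) 0 (4 : ℕ) UpperHalfPlane.I from rfl,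
      EisensteinSeries.eisensteinSeriesSIF_apply, smul_eq_mul]
    ring
  rw [h2, E₄_I] at h1
  norm_num [riemannZeta_four] at h1
  have h3 := (summable_eisSummand (k := 4) (by norm_num) UpperHalfPlane.I).hasSum
  norm_num at h3
  rw [h1] at h3
  have h4 := ((Equiv.prodComm ℤ ℤ).trans (finTwoArrowEquiv ℤ).symm).hasSum_iff.mpr h3
  rw [show (Real.pi : ℂ) ^ 4 / 60 * theta3 I ^ 8 =
    (Real.pi : ℂ) ^ 4 / 90 * (2 * (3 / 4 * theta3 I ^ 8)) by ring]
  refine h4.congr_fun fun p ↦ ?_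
  simp [EisensteinSeries.eisSummand, add_comm]

lemma gauss_pow_four_div (p : ℤ × ℤ) :
    ((p.1 : ℂ) + p.2 * I) ^ 4 * ((gaussNorm p : ℂ) ^ 4)⁻¹ = (((p.1 : ℂ) - p.2 * I) ^ 4)⁻¹ := by
  have h : (gaussNorm p : ℂ) = ((p.1 : ℂ) + p.2 * I) * (p.1 - p.2 * I) := by
    have : ((gaussNorm p : ℤ) : ℂ) = (p.1 : ℂ) ^ 2 + (p.2 : ℂ) ^ 2 := by
      rw [natCast_gaussNorm]
      push_cast
      rfl
    rw [Int.cast_natCast] at this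
    rw [this]
    linear_combination (p.2 : ℂ) ^ 2 * Complex.I_sq
  rw [h]
  -- At the origin both sides are 0 because 0⁻¹ = 0.
  by_cases h0 : (p.1 : ℂ) + p.2 * I = 0
  · have h1 := congrArg Complex.re h0
    have h2 := congrArg Complex.im h0
    simp at h1 h2
    simp [h1, h2]
  · rw [mul_pow, mul_inv, mul_inv_cancel_left₀ (pow_ne_zero 4 h0)]

lemma hasSum_gauss_conj_inv_pow_four :
    HasSum (fun p : ℤ × ℤ ↦ (((p.1 : ℂ) - p.2 * I) ^ 4)⁻¹)
      (Real.pi ^ 4 / 60 * theta3 I ^ 8) := by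
  refine (((Equiv.refl ℤ).prodCongr (Equiv.neg ℤ)).hasSum_iff.mpr
    hasSum_gauss_inv_pow_four).congr_fun fun p ↦ ?_
  simp [sub_eq_add_neg]

/-- The sum over the Gaussian integers of odd norm. -/
lemma hasSum_gauss_odd :
    HasSum (fun p : ℤ × ℤ ↦ if Even (p.1 + p.2) then 0 else
        ((p.1 : ℂ) + p.2 * I) ^ 4 * ((gaussNorm p : ℂ) ^ 4)⁻¹)
      (5 / 4 * (Real.pi ^ 4 / 60 * theta3 I ^ 8)) := by
  set F : ℤ × ℤ → ℂ := fun p ↦ (((p.1 : ℂ) - p.2 * I) ^ 4)⁻¹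
  have heven : HasSum (fun p : ℤ × ℤ ↦ if Even (p.1 + p.2) then F p else 0)
      (-1 / 4 * (Real.pi ^ 4 / 60 * theta3 I ^ 8)) := by
    -- The range of f is the set of pairs with even sum. After conjugation f is multiplication by 1
    -- - i, and (1 - i)⁴ = -4, so even norms contribute -1/4 of the total and odd norms 5/4.
    set f : ℤ × ℤ → ℤ × ℤ := fun p ↦ (p.1 + p.2, p.1 - p.2)
    have hf : f.Injective := by
      rintro ⟨a, b⟩ ⟨c, d⟩ h
      simp only [f, Prod.mk.injEq] at h ⊢
      omega
    refine (hf.hasSum_iff fun p hp ↦ ?_).mp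
      ((hasSum_gauss_inv_pow_four.mul_left (-1 / 4)).congr_fun fun p ↦ ?_)
    · rw [if_neg]
      contrapose! hp
      obtain ⟨k, hk⟩ := hp
      exact ⟨(k, p.1 - k), Prod.ext (by simp [f]) (by simp only [f]; omega)⟩
    · simp only [Function.comp_apply, f, F]
      rw [if_pos (by grind)]
      have h : ((p.1 + p.2 : ℤ) : ℂ) - ((p.1 - p.2 : ℤ) : ℂ) * I =
          (1 - I) * (p.1 + p.2 * I) := by
        push_cast
        linear_combination (p.2 : ℂ) * Complex.I_sq
      have h4 : (1 - I) ^ 4 = -4 := by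
        linear_combination (I ^ 2 - 4 * I + 5) * Complex.I_sq
      rw [h, mul_pow, h4, mul_inv]
      norm_num
  have h := hasSum_gauss_conj_inv_pow_four.sub heven
  rw [show (5 / 4 : ℂ) * (Real.pi ^ 4 / 60 * theta3 I ^ 8) =
    Real.pi ^ 4 / 60 * theta3 I ^ 8 - -1 / 4 * (Real.pi ^ 4 / 60 * theta3 I ^ 8) by ring]
  refine h.congr_fun fun p ↦ ?_
  rw [gauss_pow_four_div]
  split_ifs <;> simp [F]

/-! ### Fourier coefficients of g and the L-value -/

/-- The Fourier coefficients of the theta series of the Hecke character `α ↦ α⁴`. -/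
noncomputable def gaussCoeff (n : ℕ) : ℂ :=
  (∑' p : {p : ℤ × ℤ // gaussNorm p = n}, ((p.1.1 : ℂ) + p.1.2 * I) ^ 4) / 4

/-- Grouping by norm. Taking w(n) = qⁿ gives the Fourier expansion and w(n) = n⁻⁴ the L-value. -/
lemma hasSum_gaussCoeff_mul {w : ℕ → ℂ} {a : ℂ}
    (h : HasSum (fun p : ℤ × ℤ ↦ ((p.1 : ℂ) + p.2 * I) ^ 4 * w (gaussNorm p)) a) :
    HasSum (fun n ↦ gaussCoeff n * w n) (a / 4) := by
  have h1 := (Equiv.sigmaFiberEquiv gaussNorm).hasSum_iff.mpr h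
  have h2 := h1.sigma fun n ↦ (h1.summable.sigma_factor n).hasSum
  refine (h2.div_const 4).congr_fun fun n ↦ ?_
  have h3 (c : {p : ℤ × ℤ // gaussNorm p = n}) :
      ((fun p : ℤ × ℤ ↦ ((p.1 : ℂ) + p.2 * I) ^ 4 * w (gaussNorm p)) ∘
        (Equiv.sigmaFiberEquiv gaussNorm)) ⟨n, c⟩ =
      ((c.1.1 : ℂ) + c.1.2 * I) ^ 4 * w n := by
    simp [Equiv.sigmaFiberEquiv, c.2]
  simp only [h3]
  rw [tsum_mul_right, gaussCoeff]
  ring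

lemma gaussCoeff_zero : gaussCoeff 0 = 0 := by
  have h (p : {p : ℤ × ℤ // gaussNorm p = 0}) : ((p.1.1 : ℂ) + p.1.2 * I) ^ 4 = 0 := by
    have h1 := p.2
    simp only [gaussNorm, sqExponent] at h1
    have h2 : p.1.1 = 0 := by
      have : p.1.1.natAbs ^ 2 = 0 := by omega
      simpa using this
    have h3 : p.1.2 = 0 := by
      have : p.1.2.natAbs ^ 2 = 0 := by omega
      simpa using this
    simp [h2, h3]
  simp [gaussCoeff, h]

open Function.Periodic (qParam) in
lemma hasSum_etaQuotientG (τ : ℍ) :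
    HasSum (fun n ↦ gaussCoeff n • qParam 1 (τ : ℂ) ^ n) (etaQuotientG τ) := by
  have hq : ‖qParam 1 (τ : ℂ)‖ < 1 := Function.Periodic.norm_qParam_lt_one one_pos τ.im_pos
  have h := hasSum_gaussCoeff_mul (w := fun n ↦ qParam 1 (τ : ℂ) ^ n) (hasSum_gauss_pow_four hq)
  rw [div_div] at h
  norm_num at h
  rw [etaQuotientG_eq]
  exact h

lemma periodic_etaQuotientG :
    Function.Periodic (etaQuotientG ∘ UpperHalfPlane.ofComplex) (1 : ℝ) := by
  intro τ
  by_cases hτ : 0 < τ.im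
  · have hτ' : 0 < (τ + (1 : ℝ)).im := by simpa using hτ
    simp only [Function.comp_apply, UpperHalfPlane.ofComplex_apply_of_im_pos hτ,
      UpperHalfPlane.ofComplex_apply_of_im_pos hτ', etaQuotientG_eq]
    have : Function.Periodic.qParam 1 (τ + (1 : ℝ)) = Function.Periodic.qParam 1 τ :=
      by
      simp [Function.Periodic.qParam, mul_add, Complex.exp_add, Complex.exp_two_pi_mul_I]
    simp only [this]
  · have hτ' : (τ + (1 : ℝ)).im ≤ 0 := by simpa using hτ
    simp only [Function.comp_apply, UpperHalfPlane.ofComplex_apply_of_im_nonpos (not_lt.mp hτ),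
      UpperHalfPlane.ofComplex_apply_of_im_nonpos hτ']

open scoped Manifold in
lemma mdifferentiable_etaQuotientG :
    MDifferentiable 𝓘(ℂ) 𝓘(ℂ) etaQuotientG := by
  rw [UpperHalfPlane.mdifferentiable_iff]
  have h (k : ℕ) (hk : 0 < k) {z : ℂ} (hz : 0 < z.im) :
      DifferentiableAt ℂ (fun z : ℂ ↦ ModularForm.eta (k * z)) z :=
    (ModularForm.differentiableAt_eta_of_mem_upperHalfPlaneSet (z := k * z)
      (show 0 < (k * z).im by simpa using mul_pos (Nat.cast_pos.mpr hk) hz)).comp z (by fun_prop)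
  refine .congr (f := fun z ↦ ModularForm.eta z ^ 4 * ModularForm.eta (2 * z) ^ 2 *
    ModularForm.eta (4 * z) ^ 4) (fun z hz ↦ ?_) fun z hz ↦ ?_
  · have h1 := (h 1 one_pos hz).pow 4
    have h2 := (h 2 two_pos hz).pow 2
    have h4 := (h 4 four_pos hz).pow 4
    norm_num at h1 h2 h4
    exact ((h1.mul h2).mul h4).differentiableWithinAt
  · simp [etaQuotientG, UpperHalfPlane.ofComplex_apply_of_im_pos hz]

lemma fourierCoefficient_etaQuotientG : fourierCoefficient etaQuotientG = gaussCoeff := by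
  have han := UpperHalfPlane.analyticAt_cuspFunction_zero one_pos periodic_etaQuotientG
    mdifferentiable_etaQuotientG
    (UpperHalfPlane.isBoundedAtImInfty_of_hasSum_qExpansion one_pos hasSum_etaQuotientG)
  -- Bare functions get the identity coercion so that `UpperHalfPlane.qExpansion_coeff_unique`
  -- applies to them.
  let : FunLike (ℍ → ℂ) ℍ ℂ := ⟨id, Function.injective_id⟩
  exact funext fun n ↦
    (UpperHalfPlane.qExpansion_coeff_unique etaQuotientG one_pos han hasSum_etaQuotientG n).symm

lemma hasSum_fourier_etaQuotientG (τ : ℍ) : HasSum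
    (fun n : ℕ ↦ fourierCoefficient etaQuotientG (n + 1) *
      Complex.exp (2 * (Real.pi : ℂ) * I * ((n : ℂ) + 1) * (τ : ℂ)))
    (etaQuotientG τ) := by
  have h := (hasSum_nat_add_iff' 1).mpr (hasSum_etaQuotientG τ)
  simp only [Finset.range_one, Finset.sum_singleton, gaussCoeff_zero, zero_smul, sub_zero] at h
  refine h.congr_fun fun n ↦ ?_
  rw [fourierCoefficient_etaQuotientG, smul_eq_mul, Function.Periodic.qParam,
    ← Complex.exp_nat_mul]
  congr 2
  push_cast
  ring

/-- Termwise α⁴/N(α)⁴ = ᾱ⁻⁴, so this is a quarter of the conjugate Eisenstein sum. -/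
lemma LSeriesHasSum_etaQuotientG :
    LSeriesHasSum (fourierCoefficient etaQuotientG) 4 (Real.pi ^ 4 / 240 * theta3 I ^ 8) := by
  have h := hasSum_gaussCoeff_mul (w := fun n ↦ ((n : ℂ) ^ 4)⁻¹)
    (hasSum_gauss_conj_inv_pow_four.congr_fun gauss_pow_four_div)
  rw [LSeriesHasSum, show (Real.pi : ℂ) ^ 4 / 240 * theta3 I ^ 8 =
    Real.pi ^ 4 / 60 * theta3 I ^ 8 / 4 by ring]
  refine h.congr_fun fun n ↦ ?_
  rw [LSeries.term_def, fourierCoefficient_etaQuotientG]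
  split_ifs with hn
  · simp [hn, gaussCoeff_zero]
  · rw [div_eq_mul_inv]
    norm_cast

/-! ### Gauss's AGM integral and K' -/

section

open MeasureTheory Set Filter Topology

/-- Gauss's integral `∫₀^∞ dx / √((x² + a²)(x² + b²))`. -/
noncomputable def agmIntegral (a b : ℝ) : ℝ :=
  ∫ x in Ioi (0 : ℝ), 1 / √((x ^ 2 + a ^ 2) * (x ^ 2 + b ^ 2))

lemma integrableOn_agm {a b : ℝ} (ha : 0 < a) (hb : 0 < b) :
    IntegrableOn (fun x ↦ 1 / √((x ^ 2 + a ^ 2) * (x ^ 2 + b ^ 2))) (Ioi 0) := by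
  -- This m gives x² + a², x² + b² ≥ m²(1 + x²), so the integrand is at most m⁻²/(1 + x²).
  set m := min 1 (min a b)
  have hm : 0 < m := lt_min one_pos (lt_min ha hb)
  have hma : m ≤ a := (min_le_right _ _).trans (min_le_left _ _)
  have hmb : m ≤ b := (min_le_right _ _).trans (min_le_right _ _)
  have hm1 : m ≤ 1 := min_le_left _ _
  refine Integrable.mono' (integrable_inv_one_add_sq.const_mul (m ^ 2)⁻¹).integrableOn
    (Continuous.aestronglyMeasurable ?_) (.of_forall fun x ↦ ?_)
  · refine continuous_const.div (by fun_prop) fun x ↦ ?_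
    positivity
  · rw [Real.norm_of_nonneg (by positivity), ← mul_inv, one_div]
    refine inv_anti₀ (by positivity) (Real.le_sqrt_of_sq_le ?_)
    rw [sq]
    have h1 : m ^ 2 ≤ 1 := by nlinarith
    gcongr
    · nlinarith [sq_nonneg x, mul_self_le_mul_self hm.le hma]
    · nlinarith [sq_nonneg x, mul_self_le_mul_self hm.le hmb]

lemma agmIntegral_self {c : ℝ} (hc : 0 < c) : agmIntegral c c = Real.pi / (2 * c) := by
  have h := integral_comp_mul_left_Ioi (fun x : ℝ ↦ 1 / √((x ^ 2 + c ^ 2) * (x ^ 2 + c ^ 2))) 0 hc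
  have h1 (x : ℝ) : 1 / √(((c * x) ^ 2 + c ^ 2) * ((c * x) ^ 2 + c ^ 2)) =
      (c ^ 2)⁻¹ * (1 + x ^ 2)⁻¹ := by
    rw [Real.sqrt_mul_self (by positivity), ← mul_inv, one_div]
    congr 1
    ring
  simp only [h1, mul_zero, smul_eq_mul] at h
  rw [integral_const_mul, integral_Ioi_inv_one_add_sq, Real.arctan_zero, sub_zero] at h
  change _ = c⁻¹ * agmIntegral c c at h
  field_simp at h ⊢
  linarith

lemma agmIntegral_anti {a b c d : ℝ} (ha : 0 < a) (hb : 0 < b) (hac : a ≤ c) (hbd : b ≤ d) :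
    agmIntegral c d ≤ agmIntegral a b := by
  refine setIntegral_mono_on (integrableOn_agm (ha.trans_le hac) (hb.trans_le hbd))
    (integrableOn_agm ha hb) measurableSet_Ioi fun x _ ↦ ?_
  gcongr

lemma agmIntegral_mul {a b c : ℝ} (hc : 0 < c) :
    agmIntegral (c * a) (c * b) = c⁻¹ * agmIntegral a b := by
  have h := integral_comp_mul_left_Ioi
    (fun x : ℝ ↦ 1 / √((x ^ 2 + (c * a) ^ 2) * (x ^ 2 + (c * b) ^ 2))) 0 hc
  have h1 (x : ℝ) : 1 / √(((c * x) ^ 2 + (c * a) ^ 2) * ((c * x) ^ 2 + (c * b) ^ 2)) =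
      (c ^ 2)⁻¹ * (1 / √((x ^ 2 + a ^ 2) * (x ^ 2 + b ^ 2))) := by
    rw [show ((c * x) ^ 2 + (c * a) ^ 2) * ((c * x) ^ 2 + (c * b) ^ 2) =
      (c ^ 2) ^ 2 * ((x ^ 2 + a ^ 2) * (x ^ 2 + b ^ 2)) by ring,
      Real.sqrt_mul (by positivity), Real.sqrt_sq (by positivity)]
    rw [one_div, mul_inv, one_div]
  simp only [h1, mul_zero, smul_eq_mul] at h
  rw [integral_const_mul] at h
  change _ * agmIntegral a b = c⁻¹ * agmIntegral (c * a) (c * b) at h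
  field_simp at h ⊢
  linarith

lemma agmIntegral_comm (a b : ℝ) : agmIntegral a b = agmIntegral b a := by
  simp only [agmIntegral, mul_comm]

lemma hasDerivAt_sub_div {c x : ℝ} (hx : 0 < x) :
    HasDerivAt (fun x ↦ (x - c / x) / 2) ((1 + c / x ^ 2) / 2) x := by
  have h := ((hasDerivAt_id x).sub ((hasDerivAt_inv hx.ne').const_mul c)).div_const 2
  refine (h.congr_deriv ?_).congr_of_eventuallyEq (.of_forall fun y ↦ ?_)
  · field_simp
    ring
  · simp [div_eq_mul_inv]

lemma injOn_sub_div {c : ℝ} (hc : 0 < c) : InjOn (fun x : ℝ ↦ (x - c / x) / 2) (Ioi 0) := by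
  intro x (hx : 0 < x) y (hy : 0 < y) h
  simp only at h
  field_simp at h
  have h1 : (x - y) * (x * y + c) = 0 := by linear_combination h
  rcases mul_eq_zero.mp h1 with h2 | h2
  · linarith
  · nlinarith [mul_pos hx hy]

lemma image_sub_div {c : ℝ} (hc : 0 < c) : (fun x : ℝ ↦ (x - c / x) / 2) '' Ioi 0 = univ := by
  refine eq_univ_of_forall fun u ↦ ⟨u + √(u ^ 2 + c), ?_, ?_⟩
  · have h : |u| < √(u ^ 2 + c) := by
      rw [← Real.sqrt_sq_eq_abs]
      exact Real.sqrt_lt_sqrt (sq_nonneg u) (by linarith)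
    simp only [mem_Ioi]
    linarith [neg_abs_le u]
  · have h : |u| < √(u ^ 2 + c) := by
      rw [← Real.sqrt_sq_eq_abs]
      exact Real.sqrt_lt_sqrt (sq_nonneg u) (by linarith)
    have h0 : u + √(u ^ 2 + c) ≠ 0 := by linarith [neg_abs_le u]
    have h2 := Real.sq_sqrt (show 0 ≤ u ^ 2 + c by positivity)
    field_simp
    linear_combination h2

/-- Integrals of even functions under the substitution `u = (x - c / x) / 2`. -/
lemma integral_Ioi_eq_landen {c : ℝ} (hc : 0 < c) {g : ℝ → ℝ} (hg : ∀ x, g |x| = g x) :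
    2 * ∫ u in Ioi (0 : ℝ), g u =
      ∫ x in Ioi (0 : ℝ), (1 + c / x ^ 2) / 2 * g ((x - c / x) / 2) := by
  rw [← integral_comp_abs]
  simp only [hg]
  rw [← setIntegral_univ, ← image_sub_div hc,
    integral_image_eq_integral_abs_deriv_smul measurableSet_Ioi
      (fun x hx ↦ (hasDerivAt_sub_div hx).hasDerivWithinAt) (injOn_sub_div hc)]
  refine setIntegral_congr_fun measurableSet_Ioi fun x (hx : 0 < x) ↦ ?_
  simp only [smul_eq_mul]
  rw [abs_of_pos (by positivity)]

/-- Invariance under the arithmetic-geometric mean step. -/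
lemma agmIntegral_step {a b : ℝ} (ha : 0 < a) (hb : 0 < b) :
    agmIntegral ((a + b) / 2) (√(a * b)) = agmIntegral a b := by
  have hab := mul_pos ha hb
  have h := integral_Ioi_eq_landen hab
    (g := fun u ↦ 1 / √((u ^ 2 + ((a + b) / 2) ^ 2) * (u ^ 2 + √(a * b) ^ 2)))
    (fun x ↦ by simp only [sq_abs])
  have h2 : ∫ x in Ioi (0 : ℝ), (1 + a * b / x ^ 2) / 2 *
      (1 / √((((x - a * b / x) / 2) ^ 2 + ((a + b) / 2) ^ 2) *
        (((x - a * b / x) / 2) ^ 2 + √(a * b) ^ 2))) = 2 * agmIntegral a b := by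
    rw [agmIntegral, ← integral_const_mul]
    refine setIntegral_congr_fun measurableSet_Ioi fun x (hx : 0 < x) ↦ ?_
    -- For u = (x - ab/x)/2: u² + ((a+b)/2)² = (x²+a²)(x²+b²)/(4x²) and u² + ab = ((x + ab/x)/2)², a
    -- square that cancels against the Jacobian.
    rw [Real.sq_sqrt hab.le, show (((x - a * b / x) / 2) ^ 2 + ((a + b) / 2) ^ 2) *
      (((x - a * b / x) / 2) ^ 2 + a * b) =
      ((x + a * b / x) / (4 * x)) ^ 2 * ((x ^ 2 + a ^ 2) * (x ^ 2 + b ^ 2)) by field_simp; ring,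
      Real.sqrt_mul (by positivity), Real.sqrt_sq (by positivity)]
    have h0 : √((x ^ 2 + a ^ 2) * (x ^ 2 + b ^ 2)) ≠ 0 := by positivity
    field_simp
    ring
  have h3 : 2 * agmIntegral ((a + b) / 2) (√(a * b)) = 2 * agmIntegral a b := h.trans h2
  linarith

lemma hasDerivAt_inv_sqrt_one_add_sq (x : ℝ) :
    HasDerivAt (fun x : ℝ ↦ (√(1 + x ^ 2))⁻¹) (-(x / √(1 + x ^ 2) ^ 3)) x := by
  have h0 : √(1 + x ^ 2) ≠ 0 := by positivity
  have h := (((hasDerivAt_pow 2 x).const_add 1).sqrt (by positivity)).inv h0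
  refine h.congr_deriv ?_
  norm_num
  field_simp

lemma injOn_inv_sqrt_one_add_sq : InjOn (fun x : ℝ ↦ (√(1 + x ^ 2))⁻¹) (Ioi 0) := by
  intro x (hx : 0 < x) y (hy : 0 < y) h
  have h1 := (Real.sqrt_inj (by positivity) (by positivity)).mp (inv_injective h)
  exact (pow_left_inj₀ hx.le hy.le two_ne_zero).mp (by linarith)

lemma image_inv_sqrt_one_add_sq : (fun x : ℝ ↦ (√(1 + x ^ 2))⁻¹) '' Ioi 0 = Ioo 0 1 := by
  ext u
  constructor
  · rintro ⟨x, hx : 0 < x, rfl⟩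
    refine ⟨by positivity, inv_lt_one_of_one_lt₀ ?_⟩
    rw [Real.lt_sqrt zero_le_one]
    nlinarith
  · rintro ⟨h0, h1⟩
    have hu : 0 < (u ^ 2)⁻¹ - 1 :=
      sub_pos.mpr ((one_lt_inv₀ (by positivity)).mpr (pow_lt_one₀ h0.le h1 two_ne_zero))
    refine ⟨√((u ^ 2)⁻¹ - 1), Real.sqrt_pos.mpr hu, ?_⟩
    simp only
    rw [Real.sq_sqrt hu.le, add_sub_cancel, Real.sqrt_inv, Real.sqrt_sq h0.le, inv_inv]

/-- `K'(k)` as an integral over the half line. -/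
lemma ellipticK'_eq {k : ℝ} (hk0 : 0 < k) (hk1 : k ≤ 1) : ellipticK' k = agmIntegral 1 k := by
  have hk : 0 ≤ 1 - k ^ 2 := by nlinarith
  -- Substitution u = (1 + x²)^(-1/2).
  rw [ellipticK', ellipticK, intervalIntegral.integral_of_le zero_le_one,
    integral_Ioc_eq_integral_Ioo, ← image_inv_sqrt_one_add_sq,
    integral_image_eq_integral_abs_deriv_smul measurableSet_Ioi
      (fun x _ ↦ (hasDerivAt_inv_sqrt_one_add_sq x).hasDerivWithinAt) injOn_inv_sqrt_one_add_sq,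
    agmIntegral]
  refine setIntegral_congr_fun measurableSet_Ioi fun x (hx : 0 < x) ↦ ?_
  have hs := Real.sq_sqrt (show 0 ≤ 1 + x ^ 2 by positivity)
  have hs0 : 0 < √(1 + x ^ 2) := by positivity
  simp only [smul_eq_mul]
  rw [abs_neg, abs_of_pos (by positivity), Real.sq_sqrt hk, inv_pow, hs,
    show (1 - (1 + x ^ 2)⁻¹) * (1 - (1 - k ^ 2) * (1 + x ^ 2)⁻¹) =
      (x / (1 + x ^ 2)) ^ 2 * (x ^ 2 + k ^ 2) by field_simp; ring,
    Real.sqrt_mul (by positivity), Real.sqrt_sq (by positivity), Real.sqrt_mul (by positivity),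
    one_pow, add_comm (x ^ 2) 1, ← hs]
  have hk' : √(x ^ 2 + k ^ 2) ≠ 0 := by positivity
  field_simp
  rw [Real.sqrt_sq hs0.le]

lemma betaIntegral_quarter_half :
    ∫ w in Ioo (0 : ℝ) 1, w ^ (-3 / 4 : ℝ) * (1 - w) ^ (-1 / 2 : ℝ) =
      Real.Gamma (1 / 4) * Real.Gamma (1 / 2) / Real.Gamma (3 / 4) := by
  have h := Complex.betaIntegral_eq_Gamma_mul_div (1 / 4) (1 / 2) (by norm_num) (by norm_num)
  rw [show (1 / 4 + 1 / 2 : ℂ) = ((3 / 4 : ℝ) : ℂ) by push_cast; norm_num,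
    show (1 / 4 : ℂ) = ((1 / 4 : ℝ) : ℂ) by push_cast; rfl,
    show (1 / 2 : ℂ) = ((1 / 2 : ℝ) : ℂ) by push_cast; rfl, Complex.Gamma_ofReal,
    Complex.Gamma_ofReal, Complex.Gamma_ofReal, Complex.betaIntegral,
    intervalIntegral.integral_of_le zero_le_one, integral_Ioc_eq_integral_Ioo] at h
  have h2 : ∫ x in Ioo (0 : ℝ) 1, (x : ℂ) ^ (((1 / 4 : ℝ) : ℂ) - 1) *
      (1 - (x : ℂ)) ^ (((1 / 2 : ℝ) : ℂ) - 1) =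
      ∫ x in Ioo (0 : ℝ) 1, ((x ^ (-3 / 4 : ℝ) * (1 - x) ^ (-1 / 2 : ℝ) : ℝ) : ℂ) := by
    refine setIntegral_congr_fun measurableSet_Ioo fun x hx ↦ ?_
    rw [Complex.ofReal_mul, Complex.ofReal_cpow hx.1.le, Complex.ofReal_cpow (by linarith [hx.2])]
    push_cast
    norm_num
  rw [h2, integral_complex_ofReal] at h
  exact_mod_cast h

lemma hasDerivAt_inv_one_add_sq_sq (x : ℝ) :
    HasDerivAt (fun x : ℝ ↦ ((1 + x ^ 2) ^ 2)⁻¹) (-(4 * x / (1 + x ^ 2) ^ 3)) x := by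
  have h := (((hasDerivAt_pow 2 x).const_add 1).pow 2).inv
    (show (1 + x ^ 2) ^ 2 ≠ 0 by positivity)
  refine h.congr_deriv ?_
  norm_num
  field_simp
  ring

lemma injOn_inv_one_add_sq_sq : InjOn (fun x : ℝ ↦ ((1 + x ^ 2) ^ 2)⁻¹) (Ioi 0) := by
  intro x (hx : 0 < x) y (hy : 0 < y) h
  have h1 := (pow_left_inj₀ (by positivity) (by positivity) two_ne_zero).mp (inv_injective h)
  exact (pow_left_inj₀ hx.le hy.le two_ne_zero).mp (by linarith)

lemma image_inv_one_add_sq_sq : (fun x : ℝ ↦ ((1 + x ^ 2) ^ 2)⁻¹) '' Ioi 0 = Ioo 0 1 := by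
  ext u
  constructor
  · rintro ⟨x, hx : 0 < x, rfl⟩
    refine ⟨by positivity, inv_lt_one_of_one_lt₀ (one_lt_pow₀ (by nlinarith) two_ne_zero)⟩
  · rintro ⟨h0, h1⟩
    have hs : 0 < √u := Real.sqrt_pos.mpr h0
    have hu : 0 < (√u)⁻¹ - 1 := by
      refine sub_pos.mpr ((one_lt_inv₀ hs).mpr ?_)
      rw [Real.sqrt_lt' one_pos]
      simpa using h1
    refine ⟨√((√u)⁻¹ - 1), Real.sqrt_pos.mpr hu, ?_⟩
    simp only
    rw [Real.sq_sqrt hu.le, add_sub_cancel, inv_pow, inv_inv, Real.sq_sqrt h0.le]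

/-- The substitution w = (1 + x²)⁻² turns the lemniscatic integral into a quarter of the beta
integral B(1/4, 1/2). -/
lemma agmIntegral_one_sqrt_two :
    agmIntegral 1 √2 = Real.Gamma (1 / 4) * Real.Gamma (1 / 2) / Real.Gamma (3 / 4) / 4 := by
  rw [← betaIntegral_quarter_half, ← image_inv_one_add_sq_sq,
    integral_image_eq_integral_abs_deriv_smul measurableSet_Ioi
      (fun x _ ↦ (hasDerivAt_inv_one_add_sq_sq x).hasDerivWithinAt) injOn_inv_one_add_sq_sq,
    agmIntegral, ← integral_div]
  refine setIntegral_congr_fun measurableSet_Ioi fun x (hx : 0 < x) ↦ ?_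
  have hs := Real.sq_sqrt (show 0 ≤ 1 + x ^ 2 by positivity)
  have hs0 : 0 < √(1 + x ^ 2) := by positivity
  simp only [smul_eq_mul]
  have h1 : ((1 + x ^ 2) ^ 2)⁻¹ ^ (-3 / 4 : ℝ) = √(1 + x ^ 2) ^ 3 := by
    rw [show ((1 + x ^ 2) ^ 2)⁻¹ = √(1 + x ^ 2) ^ (-4 : ℝ) by
        rw [Real.rpow_neg hs0.le, ← hs]
        norm_num [← pow_mul, Real.sqrt_sq hs0.le],
      ← Real.rpow_mul hs0.le, ← Real.rpow_natCast _ 3]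
    norm_num
  have h2 : (1 - ((1 + x ^ 2) ^ 2)⁻¹) ^ (-1 / 2 : ℝ) = (1 + x ^ 2) / (x * √(x ^ 2 + 2)) := by
    rw [show 1 - ((1 + x ^ 2) ^ 2)⁻¹ = (x / (1 + x ^ 2)) ^ 2 * (x ^ 2 + 2) by field_simp; ring,
      show (-1 / 2 : ℝ) = -(1 / 2) by norm_num, Real.rpow_neg (by positivity),
      ← Real.sqrt_eq_rpow, Real.sqrt_mul (by positivity), Real.sqrt_sq (by positivity)]
    field_simp
  rw [h1, h2, abs_neg, abs_of_pos (by positivity), Real.sqrt_mul (by positivity),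
    Real.sq_sqrt zero_le_two, one_pow, add_comm (x ^ 2) 1, ← hs]
  have hk' : √(x ^ 2 + 2) ≠ 0 := by positivity
  field_simp
  rw [Real.sqrt_sq hs0.le]

/-! ### Theta constants on the imaginary axis and the AGM -/

/-- The theta constant `θ₂` on the imaginary axis. -/
noncomputable def theta2I (t : ℝ) : ℝ := (theta2 (I * t)).re

/-- The theta constant `θ₃` on the imaginary axis. -/
noncomputable def theta3I (t : ℝ) : ℝ := (theta3 (I * t)).re

/-- The theta constant `θ₄` on the imaginary axis. -/
noncomputable def theta4I (t : ℝ) : ℝ := (theta4 (I * t)).re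

lemma nome_I_mul (t : ℝ) : nome (I * t) = (Real.exp (-(Real.pi * t)) : ℝ) := by
  rw [nome, Complex.ofReal_exp]
  congr 1
  push_cast
  linear_combination (Real.pi * t : ℂ) * Complex.I_sq

lemma nome_I_mul_sq (t : ℝ) : nome (I * t) ^ 2 = nome (I * (2 * t : ℝ)) := by
  rw [nome, nome, ← Complex.exp_nat_mul]
  congr 1
  push_cast
  ring

lemma im_I_mul_pos {t : ℝ} (ht : 0 < t) : 0 < (I * t).im := by simpa using ht

lemma norm_nome_I_mul_lt_one {t : ℝ} (ht : 0 < t) : ‖nome (I * t)‖ < 1 :=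
  norm_nome_lt_one (im_I_mul_pos ht)

lemma thetaSeries_ofReal (c : ℤ → ℝ) (e : ℤ → ℕ) (x : ℝ) :
    thetaSeries (fun n ↦ c n) e x = ((∑' n, c n * x ^ e n : ℝ) : ℂ) := by
  simp [thetaSeries, Complex.ofReal_tsum]

lemma thetaSeries_one_ofReal (e : ℤ → ℕ) (x : ℝ) :
    thetaSeries 1 e x = ((∑' n, x ^ e n : ℝ) : ℂ) := by
  simp [thetaSeries, Complex.ofReal_tsum]

lemma IsThetaExponent.thetaSeries_pos {e : ℤ → ℕ} (he : IsThetaExponent e) {x : ℝ} (h0 : 0 < x)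
    (h1 : x < 1) : 0 < ∑' n, x ^ e n := by
  have h := he.summable_norm polyBounded_one (q := x)
    (by rwa [Complex.norm_real, Real.norm_of_nonneg h0.le])
  simp only [Pi.one_apply, one_mul, norm_pow, Complex.norm_real, Real.norm_of_nonneg h0.le] at h
  exact h.tsum_pos (fun n ↦ by positivity) 0 (by positivity)

lemma theta3_I_mul (t : ℝ) : theta3 (I * t) = theta3I t := by
  rw [theta3I, theta3, nome_I_mul, thetaA, thetaSeries_one_ofReal, Complex.ofReal_re]

lemma theta4_I_mul (t : ℝ) : theta4 (I * t) = theta4I t := by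
  have h : thetaB = thetaSeries (fun n ↦ (((-1 : ℝ) ^ n.natAbs : ℝ) : ℂ)) sqExponent := by
    simp [thetaB]
  rw [theta4I, theta4, nome_I_mul, h, thetaSeries_ofReal, Complex.ofReal_re]

lemma theta2_I_mul_eq (t : ℝ) : theta2 (I * t) = ((Real.exp (-(Real.pi * t) / 4) *
    ∑' n, Real.exp (-(Real.pi * t)) ^ pronicExponent n : ℝ) : ℂ) := by
  rw [theta2, nome_I_mul, thetaC, thetaSeries_one_ofReal, Complex.ofReal_mul, Complex.ofReal_exp]
  congr 2
  push_cast
  linear_combination (Real.pi * t / 4 : ℂ) * Complex.I_sq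

lemma theta2_I_mul (t : ℝ) : theta2 (I * t) = theta2I t := by
  rw [theta2I, theta2_I_mul_eq, Complex.ofReal_re]

lemma exp_neg_pi_mul_lt_one {t : ℝ} (ht : 0 < t) : Real.exp (-(Real.pi * t)) < 1 := by
  rw [Real.exp_lt_one_iff, neg_lt_zero]
  exact mul_pos Real.pi_pos ht

variable {t : ℝ}

lemma theta3I_pos (ht : 0 < t) : 0 < theta3I t := by
  rw [theta3I, theta3, nome_I_mul, thetaA, thetaSeries_one_ofReal, Complex.ofReal_re]
  exact isThetaExponent_sq.thetaSeries_pos (Real.exp_pos _) (exp_neg_pi_mul_lt_one ht)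

lemma theta2I_pos (ht : 0 < t) : 0 < theta2I t := by
  rw [theta2I, theta2_I_mul_eq, Complex.ofReal_re]
  exact mul_pos (Real.exp_pos _)
    (isThetaExponent_pronic.thetaSeries_pos (Real.exp_pos _) (exp_neg_pi_mul_lt_one ht))

lemma theta3I_mul_theta4I (ht : 0 < t) : theta3I t * theta4I t = theta4I (2 * t) ^ 2 := by
  have h := thetaA_mul_thetaB (norm_nome_I_mul_lt_one ht)
  rw [nome_I_mul_sq] at h
  change theta3 (I * t) * theta4 (I * t) = theta4 (I * (2 * t : ℝ)) ^ 2 at h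
  rw [theta3_I_mul, theta4_I_mul, theta4_I_mul] at h
  exact_mod_cast h

lemma theta4I_ne_zero (ht : 0 < t) : theta4I t ≠ 0 := by
  rw [← Complex.ofReal_ne_zero, ← theta4_I_mul]
  exact thetaB_ne_zero (norm_nome_I_mul_lt_one ht)

/-- The series alternates, but its product with the positive θ₃ is a nonzero square. -/
lemma theta4I_pos (ht : 0 < t) : 0 < theta4I t := by
  refine (pos_iff_pos_of_mul_pos ?_).mp (theta3I_pos ht)
  rw [theta3I_mul_theta4I ht]
  have := theta4I_ne_zero (show 0 < 2 * t by positivity)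
  positivity

lemma theta3I_sq_add_theta4I_sq (ht : 0 < t) :
    (theta3I t ^ 2 + theta4I t ^ 2) / 2 = theta3I (2 * t) ^ 2 := by
  have h1 := thetaA_sq (norm_nome_I_mul_lt_one ht)
  have h2 := thetaB_sq (norm_nome_I_mul_lt_one ht)
  rw [nome_I_mul_sq] at h1 h2
  have h : (theta3 (I * t) ^ 2 + theta4 (I * t) ^ 2) / 2 = theta3 (I * (2 * t : ℝ)) ^ 2 := by
    unfold theta3 theta4
    linear_combination (h1 + h2) / 2
  rw [theta3_I_mul, theta4_I_mul, theta3_I_mul] at h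
  exact_mod_cast h

lemma theta3I_pow_four (ht : 0 < t) : theta3I t ^ 4 = theta2I t ^ 4 + theta4I t ^ 4 := by
  have h := theta3_pow_four (I * t) (im_I_mul_pos ht)
  rw [theta3_I_mul, theta4_I_mul, theta2_I_mul] at h
  exact_mod_cast h

lemma neg_one_div_I_mul (t : ℝ) : -1 / (I * t) = I * (t⁻¹ : ℝ) := by
  rw [div_mul_eq_div_div, neg_div, one_div, Complex.inv_I, neg_neg, Complex.ofReal_inv,
    div_eq_mul_inv]

lemma neg_I_mul_I_mul (t : ℝ) : -I * (I * t) = t := by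
  linear_combination -(t : ℂ) * Complex.I_sq

lemma theta3I_inv (ht : 0 < t) : theta3I t⁻¹ ^ 2 = t * theta3I t ^ 2 := by
  have h := theta3_S (τ := I * t) (by simp [ht.ne'])
  rw [neg_one_div_I_mul, neg_I_mul_I_mul, theta3_I_mul, theta3_I_mul] at h
  exact_mod_cast h

lemma theta4I_inv (ht : 0 < t) : theta4I t⁻¹ ^ 2 = t * theta2I t ^ 2 := by
  have h := theta4_S (τ := I * t) (by simp [ht.ne'])
  rw [neg_one_div_I_mul, neg_I_mul_I_mul, theta4_I_mul, theta2_I_mul] at h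
  exact_mod_cast h

lemma theta2I_inv (ht : 0 < t) : theta2I t⁻¹ ^ 2 = t * theta4I t ^ 2 := by
  have h := theta2_S (τ := I * t) (by simp [ht.ne'])
  rw [neg_one_div_I_mul, neg_I_mul_I_mul, theta4_I_mul, theta2_I_mul] at h
  exact_mod_cast h

lemma tendsto_neg_pi_mul : Tendsto (fun t : ℝ ↦ -(Real.pi * t)) atTop atBot :=
  tendsto_neg_atTop_atBot.comp (tendsto_id.const_mul_atTop Real.pi_pos)

lemma tendsto_nome_I_mul : Tendsto (fun t : ℝ ↦ nome (I * t)) atTop (𝓝 0) := by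
  simp only [nome_I_mul]
  rw [← Complex.ofReal_zero]
  exact (Complex.continuous_ofReal.tendsto 0).comp
    (Real.tendsto_exp_atBot.comp tendsto_neg_pi_mul)

lemma tendsto_theta3I : Tendsto theta3I atTop (𝓝 1) := by
  have h := (Complex.continuous_re.tendsto _).comp
    (continuousAt_thetaA_zero.tendsto.comp tendsto_nome_I_mul)
  rwa [thetaA_zero, Complex.one_re] at h

lemma tendsto_theta4I : Tendsto theta4I atTop (𝓝 1) := by
  have h := (Complex.continuous_re.tendsto _).comp
    (continuousAt_thetaB_zero.tendsto.comp tendsto_nome_I_mul)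
  rwa [thetaB_zero, Complex.one_re] at h

/-- Doubling t performs one AGM step on (θ₃², θ₄²). -/
lemma agmIntegral_theta_two_mul (ht : 0 < t) :
    agmIntegral (theta3I (2 * t) ^ 2) (theta4I (2 * t) ^ 2) =
      agmIntegral (theta3I t ^ 2) (theta4I t ^ 2) := by
  have h3 := theta3I_pos ht
  have h4 := theta4I_pos ht
  rw [← theta3I_sq_add_theta4I_sq ht, ← theta3I_mul_theta4I ht,
    ← agmIntegral_step (by positivity : 0 < theta3I t ^ 2) (by positivity : 0 < theta4I t ^ 2),
    ← mul_pow, Real.sqrt_sq (by positivity)]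

lemma agmIntegral_theta_two_pow_mul (ht : 0 < t) (n : ℕ) :
    agmIntegral (theta3I (2 ^ n * t) ^ 2) (theta4I (2 ^ n * t) ^ 2) =
      agmIntegral (theta3I t ^ 2) (theta4I t ^ 2) := by
  induction n with
  | zero => simp
  | succ n ih => rw [← ih, pow_succ' (2 : ℝ), mul_assoc, agmIntegral_theta_two_mul (by positivity)]

lemma theta4I_sq_lt_theta3I_sq (ht : 0 < t) : theta4I t ^ 2 < theta3I t ^ 2 := by
  refine lt_of_pow_lt_pow_left₀ 2 (by positivity) ?_
  rw [← pow_mul, ← pow_mul, theta3I_pow_four ht, lt_add_iff_pos_left]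
  exact pow_pos (theta2I_pos ht) 4

lemma theta2I_sq_lt_theta3I_sq (ht : 0 < t) : theta2I t ^ 2 < theta3I t ^ 2 := by
  refine lt_of_pow_lt_pow_left₀ 2 (by positivity) ?_
  rw [← pow_mul, ← pow_mul, theta3I_pow_four ht, lt_add_iff_pos_right]
  exact pow_pos (theta4I_pos ht) 4

/-- Gauss: `AGM(θ₃², θ₄²) = 1`. -/
lemma agmIntegral_theta (ht : 0 < t) :
    agmIntegral (theta3I t ^ 2) (theta4I t ^ 2) = Real.pi / 2 := by
  have hlim : Tendsto (fun n : ℕ ↦ (2 : ℝ) ^ n * t) atTop atTop :=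
    (tendsto_pow_atTop_atTop_of_one_lt one_lt_two).atTop_mul_const ht
  have hl {f : ℝ → ℝ} (hf : Tendsto f atTop (𝓝 1)) :
      Tendsto (fun n : ℕ ↦ Real.pi / (2 * f (2 ^ n * t) ^ 2)) atTop (𝓝 (Real.pi / 2)) := by
    have h := (((hf.comp hlim).pow 2).const_mul 2).inv₀ (by norm_num)
    simpa [div_eq_mul_inv] using h.const_mul Real.pi
  -- By monotonicity the constant value lies between π/(2θ₃²) and π/(2θ₄²) at 2ⁿt, and both tend to
  -- π/2.
  refine tendsto_nhds_unique tendsto_const_nhds (tendsto_of_tendsto_of_tendsto_of_le_of_le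
    (hl tendsto_theta3I) (hl tendsto_theta4I) (fun n ↦ ?_) fun n ↦ ?_)
  all_goals
    have hn : 0 < 2 ^ n * t := by positivity
    have h3 := theta3I_pos hn
    have h4 := theta4I_pos hn
    simp only
    rw [← agmIntegral_theta_two_pow_mul ht n, ← agmIntegral_self (by positivity)]
    exact agmIntegral_anti (by positivity) (by positivity)
      (by simp [(theta4I_sq_lt_theta3I_sq hn).le]) (by simp [(theta4I_sq_lt_theta3I_sq hn).le])

/-! ### Parametrization of the modulus -/

/-- The elliptic modulus on the imaginary axis. -/
noncomputable def modulusI (t : ℝ) : ℝ := theta2I t ^ 2 / theta3I t ^ 2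

lemma modulusI_pos (ht : 0 < t) : 0 < modulusI t :=
  div_pos (pow_pos (theta2I_pos ht) 2) (pow_pos (theta3I_pos ht) 2)

lemma modulusI_lt_one (ht : 0 < t) : modulusI t < 1 :=
  (div_lt_one (pow_pos (theta3I_pos ht) 2)).mpr (theta2I_sq_lt_theta3I_sq ht)

/-- Gauss's evaluation at 1/t: inversion sends (θ₃², θ₄²) to t(θ₃², θ₂²), and homogeneity rescales
this pair to (1, k). -/
lemma ellipticK'_modulusI (ht : 0 < t) :
    ellipticK' (modulusI t) = Real.pi / 2 * t * theta3I t ^ 2 := by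
  have h3 := pow_pos (theta3I_pos ht) 2
  rw [ellipticK'_eq (modulusI_pos ht) (modulusI_lt_one ht).le]
  have h1 := agmIntegral_mul (a := 1) (b := modulusI t) h3
  have h2 := agmIntegral_theta (inv_pos.mpr ht)
  rw [theta3I_inv ht, theta4I_inv ht, agmIntegral_mul ht] at h2
  rw [mul_one, modulusI, mul_div_cancel₀ _ h3.ne'] at h1
  rw [h1] at h2
  rw [modulusI]
  field_simp at h2
  rw [div_eq_iff h3.ne'] at h2
  linarith

/-- At t = 1, θ₂² = θ₄² and θ₃² = √2 θ₂², so Gauss's evaluation becomes the integral at (1, √2); the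
reflection formula removes Γ(3/4). -/
lemma theta3I_one_sq :
    theta3I 1 ^ 2 = Real.Gamma (1 / 4) ^ 2 / (2 * Real.pi * √Real.pi) := by
  have h3 := theta3I_pos one_pos
  have h2 := theta2I_pos one_pos
  have h := theta2I_inv one_pos
  rw [inv_one, one_mul] at h
  have h4 := theta3I_pow_four one_pos
  have hs : √2 * theta2I 1 ^ 2 = theta3I 1 ^ 2 := by
    refine (pow_left_inj₀ (by positivity) (by positivity) two_ne_zero).mp ?_
    rw [mul_pow, Real.sq_sqrt zero_le_two]
    linear_combination (theta2I 1 ^ 2 + theta4I 1 ^ 2) * h - h4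
  have hA := agmIntegral_theta one_pos
  rw [← h, ← hs, mul_comm √2, ← mul_one (theta2I 1 ^ 2), mul_assoc, one_mul,
    agmIntegral_mul (by positivity), agmIntegral_comm, agmIntegral_one_sqrt_two] at hA
  have hG : Real.Gamma (1 / 4) * Real.Gamma (3 / 4) = Real.pi * √2 := by
    have := Real.Gamma_mul_Gamma_one_sub (1 / 4)
    rw [show Real.pi * (1 / 4) = Real.pi / 4 by ring, Real.sin_pi_div_four,
      show (1 - 1 / 4 : ℝ) = 3 / 4 by norm_num] at this
    rw [this]
    field_simp
    norm_num
  have hg : 0 < Real.Gamma (3 / 4) := Real.Gamma_pos_of_pos (by norm_num)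
  have hg4 : 0 < Real.Gamma (1 / 4) := Real.Gamma_pos_of_pos (by norm_num)
  have hp := Real.sq_sqrt Real.pi_pos.le
  have hs2 := Real.sq_sqrt (zero_le_two (α := ℝ))
  rw [Real.Gamma_one_half_eq] at hA
  rw [← hs]
  rw [show Real.Gamma (3 / 4) = Real.pi * √2 / Real.Gamma (1 / 4) by
    rw [← hG]; field_simp] at hA
  have hpi := Real.pi_pos
  field_simp at hA ⊢
  have hs0 : 2 * √Real.pi ≠ 0 := by positivity
  refine mul_right_cancel₀ hs0 ?_
  linear_combination -hA + 4 * theta2I 1 ^ 2 * Real.pi * √2 * hp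

lemma hasDerivAt_nome (τ : ℂ) : HasDerivAt nome (Real.pi * I * nome τ) τ := by
  have h : HasDerivAt (fun τ : ℂ ↦ Real.pi * I * τ) (Real.pi * I) τ := by
    simpa using (hasDerivAt_id τ).const_mul (Real.pi * I : ℂ)
  exact h.cexp.congr_deriv (mul_comm _ _)

lemma hasDerivAt_theta3 {τ : ℂ} (hτ : 0 < τ.im) :
    HasDerivAt theta3 (Real.pi * I * logThetaA (nome τ) * theta3 τ) τ := by
  have hq := norm_nome_lt_one hτ
  refine ((differentiableOn_thetaA.hasDerivAt_of_norm_lt hq).comp τ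
    (hasDerivAt_nome τ)).congr_deriv ?_
  have h := eulerD_thetaA hq
  rw [eulerD] at h
  rw [theta3]
  linear_combination (Real.pi * I : ℂ) * h

lemma hasDerivAt_theta2 {τ : ℂ} (hτ : 0 < τ.im) :
    HasDerivAt theta2 (Real.pi * I * logThetaC (nome τ) * theta2 τ) τ := by
  have hq := norm_nome_lt_one hτ
  have h1 : HasDerivAt (fun τ : ℂ ↦ Complex.exp (Real.pi * I * τ / 4))
      (Complex.exp (Real.pi * I * τ / 4) * (Real.pi * I / 4)) τ := by
    refine HasDerivAt.cexp ?_
    simpa using ((hasDerivAt_id τ).const_mul (Real.pi * I : ℂ)).div_const 4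
  refine (h1.mul ((differentiableOn_thetaC.hasDerivAt_of_norm_lt hq).comp τ
    (hasDerivAt_nome τ))).congr_deriv ?_
  have h := eulerD_thetaC hq
  rw [eulerD] at h
  rw [theta2]
  simp only [Function.comp_apply]
  linear_combination (Real.pi * I * Complex.exp (Real.pi * I * τ / 4) : ℂ) * h

lemma theta3_ne_zero {τ : ℂ} (hτ : 0 < τ.im) : theta3 τ ≠ 0 := thetaA_ne_zero (norm_nome_lt_one hτ)

/-- The logarithmic derivative is 2πi · D log(θ₂/θ₃), evaluated by `logThetaC_sub_logThetaA`. -/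
lemma hasDerivAt_theta2_sq_div_theta3_sq {τ : ℂ} (hτ : 0 < τ.im) :
    HasDerivAt (fun τ ↦ theta2 τ ^ 2 / theta3 τ ^ 2)
      (Real.pi * I / 2 * theta4 τ ^ 4 * (theta2 τ ^ 2 / theta3 τ ^ 2)) τ := by
  have h0 := theta3_ne_zero hτ
  refine (((hasDerivAt_theta2 hτ).pow 2).div ((hasDerivAt_theta3 hτ).pow 2)
    (pow_ne_zero 2 h0)).congr_deriv ?_
  rw [show theta4 τ ^ 4 = 4 * (logThetaC (nome τ) - logThetaA (nome τ)) by
    rw [logThetaC_sub_logThetaA (norm_nome_lt_one hτ), theta4]; ring]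
  simp only [Pi.pow_apply]
  field_simp
  push_cast
  ring

lemma hasDerivAt_modulusI (ht : 0 < t) :
    HasDerivAt modulusI (-(Real.pi / 2 * theta4I t ^ 4 * modulusI t)) t := by
  have hI : HasDerivAt (fun s : ℂ ↦ I * s) I (t : ℂ) := by
    simpa using (hasDerivAt_id (t : ℂ)).const_mul I
  have h := ((hasDerivAt_theta2_sq_div_theta3_sq (im_I_mul_pos ht)).comp (t : ℂ) hI).real_of_complex
  simp only [Function.comp_apply, theta2_I_mul, theta3_I_mul, theta4_I_mul] at h
  refine (h.congr_deriv ?_).congr_of_eventuallyEq (.of_forall fun s ↦ ?_)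
  · rw [show (Real.pi : ℂ) * I / 2 * (theta4I t : ℂ) ^ 4 * ((theta2I t : ℂ) ^ 2 / (theta3I t : ℂ) ^ 2)
      * I = ((-(Real.pi / 2 * theta4I t ^ 4 * modulusI t) : ℝ) : ℂ) by
        rw [modulusI]
        push_cast
        linear_combination (Real.pi / 2 * (theta4I t : ℂ) ^ 4 *
          ((theta2I t : ℂ) ^ 2 / (theta3I t : ℂ) ^ 2)) * Complex.I_sq, Complex.ofReal_re]
  · rw [modulusI]
    norm_cast

lemma strictAntiOn_modulusI : StrictAntiOn modulusI (Ioi 0) := by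
  refine strictAntiOn_of_deriv_neg (convex_Ioi 0)
    (fun t ht ↦ (hasDerivAt_modulusI ht).continuousAt.continuousWithinAt) fun t ht ↦ ?_
  rw [interior_Ioi] at ht
  have h4 := theta4I_pos ht
  have hk := modulusI_pos ht
  rw [(hasDerivAt_modulusI ht).deriv, neg_lt_zero]
  positivity

lemma tendsto_modulusI_atTop : Tendsto modulusI atTop (𝓝 0) := by
  have h := (((tendsto_theta4I.pow 4).div (tendsto_theta3I.pow 4) (by norm_num)).const_sub 1).sqrt
  norm_num at h
  refine h.congr' ((eventually_gt_atTop 0).mono fun t ht ↦ ?_)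
  have h3 := theta3I_pos ht
  rw [show 1 - theta4I t ^ 4 / theta3I t ^ 4 = modulusI t ^ 2 by
    rw [modulusI]
    field_simp
    linear_combination theta3I_pow_four ht, Real.sqrt_sq (modulusI_pos ht).le]

lemma tendsto_modulusI_zero : Tendsto modulusI (𝓝[>] 0) (𝓝 1) := by
  have h := ((tendsto_theta4I.pow 2).div (tendsto_theta3I.pow 2) (by norm_num)).comp
    tendsto_inv_nhdsGT_zero
  norm_num at h
  refine h.congr' (eventually_mem_nhdsWithin.mono fun t (ht : 0 < t) ↦ ?_)
  have h3 := theta3I_pos ht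
  simp only [Function.comp_apply, Pi.div_apply, modulusI]
  rw [theta4I_inv ht, theta3I_inv ht, mul_div_mul_left _ _ ht.ne']

lemma image_modulusI : modulusI '' Ioi 0 = Ioo 0 1 := by
  refine Subset.antisymm ?_ ?_
  · rintro _ ⟨t, ht, rfl⟩
    exact ⟨modulusI_pos ht, modulusI_lt_one ht⟩
  · exact isPreconnected_Ioi.intermediate_value_Ioo (l₁ := atTop) (l₂ := 𝓝[>] 0)
      (le_principal_iff.mpr (Ioi_mem_atTop 0)) inf_le_right
      (fun t ht ↦ (hasDerivAt_modulusI ht).continuousAt.continuousWithinAt)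
      tendsto_modulusI_atTop tendsto_modulusI_zero

/-! ### The moment as a Mellin transform -/

lemma abs_deriv_mul_ellipticK'_cube (ht : 0 < t) :
    |-(Real.pi / 2 * theta4I t ^ 4 * modulusI t)| • ellipticK' (modulusI t) ^ 3 =
      (Real.pi / 2) ^ 4 * (t ^ 3 * (theta2I t ^ 2 * theta3I t ^ 4 * theta4I t ^ 4)) := by
  have h3 := theta3I_pos ht
  have h4 := theta4I_pos ht
  have hk := modulusI_pos ht
  rw [abs_neg, abs_of_pos (by positivity), ellipticK'_modulusI ht, modulusI, smul_eq_mul]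
  field_simp

lemma theta3_I_pow_eight :
    theta3 I ^ 8 = ((Real.Gamma (1 / 4) ^ 8 / (16 * Real.pi ^ 6) : ℝ) : ℂ) := by
  have h := theta3_I_mul 1
  rw [Complex.ofReal_one, mul_one] at h
  rw [h, ← Complex.ofReal_pow, show theta3I 1 ^ 8 = (theta3I 1 ^ 2) ^ 4 by ring, theta3I_one_sq,
    div_pow, mul_pow _ √Real.pi, show √Real.pi ^ 4 = (√Real.pi ^ 2) ^ 2 by ring,
    Real.sq_sqrt Real.pi_pos.le]
  congr 2 <;> ring

/-- `hasSum_gauss_pow_four_odd` at q = e^(-πt/2), whose square is the nome of it; hence the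
exponents N(α)/2. -/
lemma hasSum_theta_pow_I_mul (ht : 0 < t) :
    HasSum (fun p : ℤ × ℤ ↦ (if Even (p.1 + p.2) then 0 else ((p.1 : ℂ) + p.2 * I) ^ 4) *
        Real.exp (-Real.pi * (gaussNorm p / 2) * t))
      ((theta2I t ^ 2 * theta3I t ^ 4 * theta4I t ^ 4 : ℝ) : ℂ) := by
  set q : ℂ := ((Real.exp (-(Real.pi * (t / 2))) : ℝ) : ℂ)
  have hq : ‖q‖ < 1 := by
    rw [Complex.norm_real, Real.norm_of_nonneg (Real.exp_pos _).le]
    exact exp_neg_pi_mul_lt_one (by positivity)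
  have hq2 : q ^ 2 = nome (I * t) := by
    rw [nome_I_mul]
    simp only [q]
    rw [← Complex.ofReal_pow, ← Real.exp_nat_mul]
    congr 2
    push_cast
    ring
  have h2 : theta2 (I * t) ^ 2 = q * thetaC (nome (I * t)) ^ 2 := by
    rw [theta2, mul_pow, ← Complex.exp_nat_mul]
    congr 1
    simp only [q]
    rw [Complex.ofReal_exp]
    congr 1
    push_cast
    linear_combination (Real.pi * t / 2 : ℂ) * Complex.I_sq
  have h := hasSum_gauss_pow_four_odd hq
  rw [hq2, ← h2] at h
  change HasSum _ (theta2 (I * t) ^ 2 * theta3 (I * t) ^ 4 * theta4 (I * t) ^ 4) at h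
  rw [theta2_I_mul, theta3_I_mul, theta4_I_mul] at h
  rw [Complex.ofReal_mul, Complex.ofReal_mul, Complex.ofReal_pow, Complex.ofReal_pow,
    Complex.ofReal_pow]
  refine h.congr_fun fun p ↦ ?_
  split_ifs with hp
  · simp
  · simp only [q]
    rw [← Complex.ofReal_pow, ← Real.exp_nat_mul]
    congr 3
    ring

/-- Termwise integration gives Γ(4)(2/π)⁴ = 96/π⁴ times the odd Eisenstein sum. -/
lemma mellin_theta_pow_eq : mellin (fun t ↦
    ((theta2I t ^ 2 * theta3I t ^ 4 * theta4I t ^ 4 : ℝ) : ℂ)) 4 = 2 * theta3 I ^ 8 := by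
  have hpi : (Real.pi : ℂ) ≠ 0 := Complex.ofReal_ne_zero.mpr Real.pi_ne_zero
  have h := hasSum_mellin_pi_mul (s := 4)
    (a := fun p : ℤ × ℤ ↦ if Even (p.1 + p.2) then 0 else ((p.1 : ℂ) + p.2 * I) ^ 4)
    (q := fun p ↦ gaussNorm p / 2) (fun p ↦ ?_) (by norm_num)
    (fun t ht ↦ hasSum_theta_pow_I_mul ht) ?_
  · refine h.unique ?_
    have hG : Complex.Gamma 4 = 6 := by
      have := Complex.Gamma_nat_eq_factorial 3
      rw [show ((3 : ℕ) : ℂ) + 1 = 4 by norm_num] at this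
      rw [this]
      norm_num [Nat.factorial]
    rw [show 2 * theta3 I ^ 8 = 96 / (Real.pi : ℂ) ^ 4 *
      (5 / 4 * (Real.pi ^ 4 / 60 * theta3 I ^ 8)) by field_simp; ring]
    refine (hasSum_gauss_odd.mul_left _).congr_fun fun p ↦ ?_
    rw [hG, Complex.cpow_neg]
    norm_num only [Complex.cpow_ofNat, Complex.ofReal_div, Complex.ofReal_natCast,
      Complex.ofReal_ofNat]
    split_ifs
    · simp
    · rw [div_pow]
      by_cases h0 : (gaussNorm p : ℂ) = 0
      · simp [h0]
      · field_simp
        ring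
  · by_cases hp : Even (p.1 + p.2)
    · simp [hp]
    · right
      have : gaussNorm p ≠ 0 := fun h0 ↦ hp ((even_gaussNorm_iff p).mp (by simp [h0]))
      positivity
  · refine (hasSum_gauss_odd.summable.norm.mul_left 16).congr fun p ↦ ?_
    rw [show (4 : ℂ).re = ((4 : ℕ) : ℝ) by norm_num, Real.rpow_natCast]
    split_ifs
    · simp
    · rw [norm_mul, norm_inv, norm_pow (gaussNorm p : ℂ), Complex.norm_natCast, div_pow,
        div_div_eq_mul_div, div_eq_mul_inv]
      ring

lemma integral_theta_pow : ∫ t in Ioi (0 : ℝ),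
    t ^ 3 * (theta2I t ^ 2 * theta3I t ^ 4 * theta4I t ^ 4) =
      Real.Gamma (1 / 4) ^ 8 / (8 * Real.pi ^ 6) := by
  have h := mellin_theta_pow_eq
  rw [mellin, theta3_I_pow_eight] at h
  have h1 (t : ℝ) : (t : ℂ) ^ (4 - 1 : ℂ) •
      ((theta2I t ^ 2 * theta3I t ^ 4 * theta4I t ^ 4 : ℝ) : ℂ) =
      ((t ^ 3 * (theta2I t ^ 2 * theta3I t ^ 4 * theta4I t ^ 4) : ℝ) : ℂ) := by
    rw [show (4 - 1 : ℂ) = ((3 : ℕ) : ℂ) by norm_num, Complex.cpow_natCast, smul_eq_mul]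
    push_cast
    rfl
  simp only [h1] at h
  rw [integral_complex_ofReal, ← Complex.ofReal_ofNat, ← Complex.ofReal_mul] at h
  rw [Complex.ofReal_inj.mp h]
  ring

/-- A non-integrable function has Bochner integral 0 by convention, whereas the value found is
positive. -/
lemma integrableOn_theta_pow : IntegrableOn (fun t ↦
    t ^ 3 * (theta2I t ^ 2 * theta3I t ^ 4 * theta4I t ^ 4)) (Ioi 0) := by
  refine .of_integral_ne_zero ?_
  rw [integral_theta_pow]
  have : 0 < Real.Gamma (1 / 4) := Real.Gamma_pos_of_pos (by norm_num)
  positivity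

lemma intervalIntegrable_ellipticK'_cube :
    IntervalIntegrable (fun k : ℝ ↦ ellipticK' k ^ 3) volume 0 1 := by
  rw [intervalIntegrable_iff_integrableOn_Ioo_of_le zero_le_one, ← image_modulusI,
    integrableOn_image_iff_integrableOn_abs_deriv_smul measurableSet_Ioi
      (fun t ht ↦ (hasDerivAt_modulusI ht).hasDerivWithinAt) strictAntiOn_modulusI.injOn]
  exact IntegrableOn.congr_fun (integrableOn_theta_pow.const_mul _)
    (fun t ht ↦ (abs_deriv_mul_ellipticK'_cube ht).symm) measurableSet_Ioi

lemma integral_ellipticK'_cube :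
    ∫ k in (0 : ℝ)..1, ellipticK' k ^ 3 = Real.Gamma (1 / 4) ^ 8 / (128 * Real.pi ^ 2) := by
  rw [intervalIntegral.integral_of_le zero_le_one, integral_Ioc_eq_integral_Ioo, ← image_modulusI,
    integral_image_eq_integral_abs_deriv_smul measurableSet_Ioi
      (fun t ht ↦ (hasDerivAt_modulusI ht).hasDerivWithinAt) strictAntiOn_modulusI.injOn,
    setIntegral_congr_fun measurableSet_Ioi fun t ht ↦ abs_deriv_mul_ellipticK'_cube ht,
    integral_const_mul, integral_theta_pow]
  have := Real.pi_ne_zero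
  field_simp
  norm_num

end

theorem theorem3p2 :
    -- the Fourier series of `g`, whose coefficients define its `L`-series
    (∀ τ : ℍ, HasSum
      (fun n : ℕ ↦ fourierCoefficient etaQuotientG (n + 1) *
        Complex.exp (2 * (Real.pi : ℂ) * I * ((n : ℂ) + 1) * (τ : ℂ)))
      (etaQuotientG τ)) ∧
    -- `L(g, 4)`: the series converges absolutely, and its sum is as stated
    LSeriesHasSum (fourierCoefficient etaQuotientG) 4
      ((Real.Gamma (1 / 4) ^ 8 / (3840 * Real.pi ^ 2) : ℝ) : ℂ) ∧
    -- the moment of `K'^3`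
    IntervalIntegrable (fun k : ℝ ↦ ellipticK' k ^ 3) MeasureTheory.volume 0 1 ∧
    ∫ k in (0 : ℝ)..1, ellipticK' k ^ 3 = Real.Gamma (1 / 4) ^ 8 / (128 * Real.pi ^ 2) := by
  refine ⟨hasSum_fourier_etaQuotientG, ?_, intervalIntegrable_ellipticK'_cube,
    integral_ellipticK'_cube⟩
  have h := LSeriesHasSum_etaQuotientG
  rw [theta3_I_pow_eight] at h
  convert! h using 1
  rw [show Real.Gamma (1 / 4) ^ 8 / (3840 * Real.pi ^ 2) =
    Real.pi ^ 4 / 240 * (Real.Gamma (1 / 4) ^ 8 / (16 * Real.pi ^ 6)) by field_simp; norm_num]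
  push_cast
  rfl
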